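/- **Definitions.** Let $\mathsf{RCC8}=\{\mathsf{dc},\mathsf{ec},\mathsf{po},\mathsf{eq},\mathsf{tpp},\mathsf{ntpp},\mathsf{tppi},\mathsf{ntppi}\}$. For non-empty regular closed subsets $s,t$ of a topological space with interior operator $\mathbb I$: $\mathsf{dc}(s,t)$ iff $s\cap t=\emptyset$; $\mathsf{ec}(s,t)$ iff $\mathbb I s\cap\mathbb I t=\emptyset$ and $s\cap t\ne\emptyset$; $\mathsf{po}(s,t)$ iff $\mathbb I s\cap\mathbb I t\neq\emptyset$, $s\not\subseteq t$ and $t\not\subseteq s$; $\mathsf{eq}(s,t)$ iff $s=t$; $\mathsf{tpp}(s,t)$ iff $s\subseteq t$, $s\not\subseteq\mathbb I t$ and $s\ne t$; $\mathsf{ntpp}(s,t)$ iff $s\subseteq \mathbb I t$ and $s\neq t$; $\mathsf{tppi}$ and $\mathsf{ntppi}$ are the inverses of $\mathsf{tpp}$ and $\mathsf{ntpp}$. For a set $U$ of regions (non-empty regular closed sets) of a space $\mathfrak T$, $\mathfrak R(\mathfrak T,U)$ is the structure with domain $U$ and these eight relations. $\mathbb R^n_{\mathsf{reg}}$ is the set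 of all non-empty regular closed subsets of $\mathbb R^n$, and $\mathbb R^n_{\mathsf{rect}}$ is the set of all products $\prod_{i=1}^n C_i$ of non-singleton closed (possibly unbounded) intervals $C_i\subseteq\mathbb R$. $\mathcal{TOP}$ is the class of all structures $\mathfrak R(\mathfrak T,U)$, where $\mathfrak T$ is a non-empty topological space and $U$ is the set of all its non-empty regular closed subsets. A (general) region structure is a non-empty set $W$ with eight mutually disjoint and jointly exhaustive binary relations, named by the elements of $\mathsf{RCC8}$, such that $\mathsf{eq}$ is the identity, $\mathsf{dc},\mathsf{ec},\mathsf{po}$ are symmetric, $\mathsf{tppi},\mathsf{ntppi}$ are the inverses of $\mathsf{tpp},\mathsf{ntpp}$, and the $\mathsf{RCC8}$ composition table holds. $\mathcal{RS}$ is the class of all region structures. Formulas of $\mathcal L_{\mathsf{RCC8}}$ are built from countably many propositional variables by $\neg$, $\wedge$ and a box $[\mathsf r]$ for each $\mathsf r\in\mathsf{RCC8}$, with Kripke semantics: $[\mathsf r]\varphi$ is true at $s$ iff $\varphi$ is true at all $t$ with $\mathsf r(s,t)$. For a class $\mathcal S$ of structures, $L^{\mathsf{fin}}_{\mathsf{RCC8}}(\mathcal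 S)$ is the set of all formulas that are true at all elements under all valuations in all finite non-empty (induced) substructures of members of $\mathcal S$. **Theorem.** Let $n\ge 1$ and let $\mathcal S\subseteq\mathcal{RS}$ be a class of region structures that contains $\mathfrak R(\mathbb R^n,\mathbb R^n_{\mathsf{rect}})$ (or an isomorphic copy of it). Then $L^{\mathsf{fin}}_{\mathsf{RCC8}}(\mathcal S)$ is undecidable. Moreover, for every $n\ge1$, the logics $L^{\mathsf{fin}}_{\mathsf{RCC8}}(\mathcal{RS})$, $L^{\mathsf{fin}}_{\mathsf{RCC8}}(\mathcal{TOP})$, $L^{\mathsf{fin}}_{\mathsf{RCC8}}(\{\mathfrak R(\mathbb R^n,\mathbb R^n_{\mathsf{reg}})\})$ and $L^{\mathsf{fin}}_{\mathsf{RCC8}}(\{\mathfrak R(\mathbb R^n,\mathbb R^n_{\mathsf{rect}})\})$ are not recursively enumerable. -/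

import Mathlib

/-- The eight Egenhofer-Franzosa (`RCC8`) relation symbols. -/
inductive RCC8 where
  | dc | ec | po | eq | tpp | ntpp | tppi | ntppi
  deriving DecidableEq

namespace RCC8

/-- The extension of an `RCC8` relation on subsets of a topological space. -/
def Holds {X : Type*} [TopologicalSpace X] : RCC8 → Set X → Set X → Prop
  | dc, s, t => s ∩ t = ∅
  | ec, s, t => interior s ∩ interior t = ∅ ∧ s ∩ t ≠ ∅
  | po, s, t => interior s ∩ interior t ≠ ∅ ∧ ¬ s ⊆ t ∧ ¬ t ⊆ s
  | eq, s, t => s = t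
  | tpp, s, t => s ⊆ t ∧ ¬ s ⊆ interior t ∧ s ≠ t
  | ntpp, s, t => s ⊆ interior t ∧ s ≠ t
  | tppi, s, t => t ⊆ s ∧ ¬ t ⊆ interior s ∧ t ≠ s
  | ntppi, s, t => t ⊆ interior s ∧ t ≠ s

/-- The inverse of a relation symbol. -/
def inv : RCC8 → RCC8
  | tpp => tppi
  | ntpp => ntppi
  | tppi => tpp
  | ntppi => ntpp
  | r => r

/-- The list of all relation symbols. -/
def all : List RCC8 := [dc, ec, po, eq, tpp, ntpp, tppi, ntppi]

/-- The `RCC8` composition table: `comp r₁ r₂` lists the relations that may hold between `x` and `z`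
when `r₁ x y` and `r₂ y z`. -/
def comp : RCC8 → RCC8 → List RCC8
  | eq, r => [r]
  | r, eq => [r]
  | dc, dc => all
  | dc, ec => [dc, ec, po, tpp, ntpp]
  | dc, tpp => [dc, ec, po, tpp, ntpp]
  | dc, tppi => [dc]
  | dc, po => [dc, ec, po, tpp, ntpp]
  | dc, ntpp => [dc, ec, po, tpp, ntpp]
  | dc, ntppi => [dc]
  | ec, dc => [dc, ec, po, tppi, ntppi]
  | ec, ec => [dc, ec, po, tpp, tppi, eq]
  | ec, tpp => [ec, po, tpp, ntpp]
  | ec, tppi => [dc, ec]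
  | ec, po => [dc, ec, po, tpp, ntpp]
  | ec, ntpp => [po, tpp, ntpp]
  | ec, ntppi => [dc]
  | tpp, dc => [dc]
  | tpp, ec => [dc, ec]
  | tpp, tpp => [tpp, ntpp]
  | tpp, tppi => [dc, ec, po, tpp, tppi, eq]
  | tpp, po => [dc, ec, po, tpp, ntpp]
  | tpp, ntpp => [ntpp]
  | tpp, ntppi => [dc, ec, po, tppi, ntppi]
  | tppi, dc => [dc, ec, po, tppi, ntppi]
  | tppi, ec => [ec, po, tppi, ntppi]
  | tppi, tpp => [po, eq, tpp, tppi]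
  | tppi, tppi => [tppi, ntppi]
  | tppi, po => [po, tppi, ntppi]
  | tppi, ntpp => [po, tpp, ntpp]
  | tppi, ntppi => [ntppi]
  | po, dc => [dc, ec, po, tppi, ntppi]
  | po, ec => [dc, ec, po, tppi, ntppi]
  | po, tpp => [po, tpp, ntpp]
  | po, tppi => [dc, ec, po, tppi, ntppi]
  | po, po => all
  | po, ntpp => [po, tpp, ntpp]
  | po, ntppi => [dc, ec, po, tppi, ntppi]
  | ntpp, dc => [dc]
  | ntpp, ec => [dc]
  | ntpp, tpp => [ntpp]
  | ntpp, tppi => [dc, ec, po, tpp, ntpp]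
  | ntpp, po => [dc, ec, po, tpp, ntpp]
  | ntpp, ntpp => [ntpp]
  | ntpp, ntppi => all
  | ntppi, dc => [dc, ec, po, tppi, ntppi]
  | ntppi, ec => [po, tppi, ntppi]
  | ntppi, tpp => [po, tppi, ntppi]
  | ntppi, tppi => [ntppi]
  | ntppi, po => [po, tppi, ntppi]
  | ntppi, ntpp => [po, tppi, tpp, ntpp, ntppi, eq]
  | ntppi, ntppi => [ntppi]

/-- The position of a relation symbol in a fixed enumeration of the eight symbols. -/
def idx : RCC8 → ℕ
  | dc => 0
  | ec => 1
  | po => 2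
  | eq => 3
  | tpp => 4
  | ntpp => 5
  | tppi => 6
  | ntppi => 7

/-- The relation symbol at a given position. -/
def ofIdx : ℕ → RCC8
  | 0 => dc
  | 1 => ec
  | 2 => po
  | 3 => eq
  | 4 => tpp
  | 5 => ntpp
  | 6 => tppi
  | _ => ntppi

theorem idx_lt (r : RCC8) : r.idx < 8 := by cases r <;> decide

theorem ofIdx_idx (r : RCC8) : ofIdx r.idx = r := by cases r <;> rfl

theorem idx_ofIdx (k : ℕ) (hk : k < 8) : (ofIdx k).idx = k := by
  interval_cases k <;> rfl

end RCC8

universe u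

/-- A relational structure with eight binary relations, one for each `RCC8` symbol. -/
structure RCC8Structure where
  /-- the domain -/
  W : Type u
  /-- the interpretation of the relation symbols -/
  rel : RCC8 → W → W → Prop

namespace RCC8Structure

/-- General region structures: the domain is non-empty, the relations are mutually disjoint and
jointly exhaustive, `eq` is the identity, `dc`, `ec`, `po` are symmetric, `tppi`, `ntppi` are the
inverses of `tpp`, `ntpp`, and the composition table is respected. -/
structure IsRegionStructure (R : RCC8Structure.{u}) : Prop where
  nonempty : Nonempty R.W
  disjoint : ∀ r q x y, R.rel r x y → R.rel q x y → r = q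
  exhaustive : ∀ x y, ∃ r, R.rel r x y
  eq_iff : ∀ x y, R.rel RCC8.eq x y ↔ x = y
  inv_iff : ∀ r x y, R.rel r x y ↔ R.rel r.inv y x
  comp : ∀ r₁ r₂ x y z, R.rel r₁ x y → R.rel r₂ y z → ∃ q ∈ RCC8.comp r₁ r₂, R.rel q x z

/-- The substructure induced by a set of elements. -/
def restrict (R : RCC8Structure.{u}) (A : Set R.W) : RCC8Structure.{u} where
  W := A
  rel r x y := R.rel r x y

/-- Isomorphisms of structures. -/
structure Iso (R : RCC8Structure.{u}) (R' : RCC8Structure) extends R.W ≃ R'.W where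
  rel_iff : ∀ r x y, R'.rel r (toEquiv x) (toEquiv y) ↔ R.rel r x y

/-- The concrete structure induced by a topological space `X` and a set `U` of regions in it. -/
def concrete (X : Type u) [TopologicalSpace X] (U : Set (Set X)) : RCC8Structure.{u} where
  W := U
  rel r s t := r.Holds (s : Set X) (t : Set X)

end RCC8Structure

/-- The non-empty regular closed subsets of a topological space. -/
def regRegions (X : Type u) [TopologicalSpace X] : Set (Set X) :=
  {s | s.Nonempty ∧ closure (interior s) = s}

/-- The closed hyper-rectangles of `ℝⁿ`: products of non-singleton (hence non-degenerate) closed,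
possibly unbounded, intervals. -/
def rectRegions (n : ℕ) : Set (Set (Fin n → ℝ)) :=
  {s | ∃ C : Fin n → Set ℝ,
    (∀ i, IsClosed (C i) ∧ (C i).OrdConnected ∧ (C i).Nontrivial) ∧ s = Set.univ.pi C}

/-- The region structure of all closed hyper-rectangles of `ℝⁿ` (the product topology of
`Fin n → ℝ` is the Euclidean one). -/
def rectStructure (n : ℕ) : RCC8Structure.{0} :=
  RCC8Structure.concrete (Fin n → ℝ) (rectRegions n)

/-- The region structure of all non-empty regular closed subsets of `ℝⁿ`. -/
def regStructure (n : ℕ) : RCC8Structure.{0} :=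
  RCC8Structure.concrete (Fin n → ℝ) (regRegions (Fin n → ℝ))

/-- The class `RS` of all general region structures. -/
def classRS : Set RCC8Structure.{u} :=
  {R | R.IsRegionStructure}

/-- The class `TOP` of the structures of all non-empty regular closed sets of a (non-empty)
topological space. -/
def classTOP : Set RCC8Structure.{u} :=
  {R | ∃ (X : Type u) (_ : TopologicalSpace X), Nonempty X ∧
    R = RCC8Structure.concrete X (regRegions X)}

/-- The modal formulas over `RCC8`: propositional variables, negation, conjunction and one box for
each relation symbol. -/
inductive RCC8Formula where
  | var (i : ℕ)
  | neg (φ : RCC8Formula)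
  | and (φ ψ : RCC8Formula)
  | box (r : RCC8) (φ : RCC8Formula)

namespace RCC8Formula

/-- Truth of a formula at an element of a structure under a valuation. -/
def Sat (R : RCC8Structure.{u}) (V : ℕ → Set R.W) : R.W → RCC8Formula → Prop
  | s, var i => s ∈ V i
  | s, neg φ => ¬ Sat R V s φ
  | s, and φ ψ => Sat R V s φ ∧ Sat R V s ψ
  | s, box r φ => ∀ t, R.rel r s t → Sat R V t φ

/-- A Gödel numbering of formulas. -/
def toNat : RCC8Formula → ℕ
  | var i => 4 * i
  | neg φ => 4 * φ.toNat + 1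
  | and φ ψ => 4 * Nat.pair φ.toNat ψ.toNat + 2
  | box r φ => 4 * (8 * φ.toNat + r.idx) + 3

/-- The formula with a given Gödel number. -/
def ofNat (k : ℕ) : RCC8Formula :=
  if _h0 : k % 4 = 0 then var (k / 4)
  else if _h1 : k % 4 = 1 then neg (ofNat (k / 4))
  else if _h2 : k % 4 = 2 then
    and (ofNat (Nat.unpair (k / 4)).1) (ofNat (Nat.unpair (k / 4)).2)
  else box (RCC8.ofIdx (k / 4 % 8)) (ofNat (k / 4 / 8))
termination_by k
decreasing_by
  · omega
  · have := Nat.unpair_left_le (k / 4)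
    omega
  · have := Nat.unpair_right_le (k / 4)
    omega
  · omega

theorem ofNat_toNat (φ : RCC8Formula) : ofNat φ.toNat = φ := by
  induction φ with
  | var i =>
    rw [toNat, ofNat, dif_pos (by omega)]
    congr 1
    omega
  | neg φ ih =>
    rw [toNat, ofNat, dif_neg (by omega), dif_pos (by omega)]
    rw [show (4 * φ.toNat + 1) / 4 = φ.toNat by omega, ih]
  | and φ ψ ih₁ ih₂ =>
    rw [toNat, ofNat, dif_neg (by omega), dif_neg (by omega), dif_pos (by omega)]
    rw [show (4 * Nat.pair φ.toNat ψ.toNat + 2) / 4 = Nat.pair φ.toNat ψ.toNat by omega,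
      Nat.unpair_pair, ih₁, ih₂]
  | box r φ ih =>
    have hr := r.idx_lt
    rw [toNat, ofNat, dif_neg (by omega), dif_neg (by omega), dif_neg (by omega)]
    rw [show (4 * (8 * φ.toNat + r.idx) + 3) / 4 % 8 = r.idx by omega,
      show (4 * (8 * φ.toNat + r.idx) + 3) / 4 / 8 = φ.toNat by omega, ih, RCC8.ofIdx_idx]

theorem toNat_ofNat (k : ℕ) : (ofNat k).toNat = k := by
  induction k using Nat.strong_induction_on with
  | _ k ih =>
    rw [ofNat]
    split_ifs with h0 h1 h2
    · rw [toNat]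
      omega
    · rw [toNat, ih _ (by omega)]
      omega
    · have hl := Nat.unpair_left_le (k / 4)
      have hr := Nat.unpair_right_le (k / 4)
      rw [toNat, ih _ (by omega), ih _ (by omega), Nat.pair_unpair]
      omega
    · rw [toNat, ih _ (by omega), RCC8.idx_ofIdx _ (by omega)]
      omega

/-- The Gödel numbering is a bijection with `ℕ`. -/
def equivNat : RCC8Formula ≃ ℕ where
  toFun := toNat
  invFun := ofNat
  left_inv := ofNat_toNat
  right_inv := toNat_ofNat

/-- Computability of problems about formulas refers to their Gödel numbers. -/
instance : Primcodable RCC8Formula := Primcodable.ofEquiv ℕ equivNat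

end RCC8Formula

/-- The logic of a class of structures: all formulas that are true at all elements of all models
based on structures from the class. -/
def rcc8Logic (S : Set RCC8Structure.{u}) : Set RCC8Formula :=
  {φ | ∀ R ∈ S, ∀ (V : ℕ → Set R.W) (s : R.W), φ.Sat R V s}

/-- The class of all finite (non-empty) substructures of structures from `S`. -/
def finiteSubstructures (S : Set RCC8Structure.{u}) : Set RCC8Structure.{u} :=
  {R | ∃ R' ∈ S, ∃ A : Set R'.W, A.Finite ∧ A.Nonempty ∧ R = R'.restrict A}

/-- The logic of all finite substructures of structures from `S`. -/
def rcc8FinLogic (S : Set RCC8Structure.{u}) : Set RCC8Formula :=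
  rcc8Logic (finiteSubstructures S)

/-!
Whether a program halts is reduced to membership of a modal formula in the logic of finite
substructures, in such a way that a program does *not* halt if and only if its formula belongs to the
logic. As non-halting is not recursively enumerable, neither is the logic, and it is undecidable all
the more. One reduction serves all classes of region structures at once: the formulas constructed
from non-halting programs are refutable in no finite region structure whatsoever, those constructed
from halting programs are refuted by finitely many intervals of the real line, or by their products
with unbounded sides (`neg_formula_mem_rcc8FinLogic_iff`).

The formula describes a space-time diagram of a Turing machine, written row by row along a chain of
regions. In terms of intervals around the origin, a pair `(a, b)` stands for `[-(a + 1), b + 1]`; two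
such intervals are in the relation `ntpp` if both ends move outwards, and in the relation `tpp` if
exactly one does. The cells of the diagram are the symmetric intervals `(i, i)`. The connector
`(i, i + 1)` lies tangentially between the cells `i` and `i + 1`, and the connector `(i + m, i)`
between the cells `i` and `i + m`; these are the next cell in the row and the cell in the next row,
if rows have length `m`.

The composition table suffices to recognize this pattern in an arbitrary finite region structure.
Suppose that cells are pairwise in the relation `ntpp` or its inverse, and so are the connectors of
each sort. As `ntpp` composed with `tpp`, in either order, is `ntpp`, a connector has at most one cell
tangentially below it and at most one tangentially above it, and the induced partial map on cells is
strictly monotone (`RCC8Structure.IsRegionStructure.linked_mono`). If moreover its domain is an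
initial segment and its range is a final segment, then it is a shift by a constant
(`exists_shift_of_strictMono`). These conditions can be expressed by a modal formula, whence every
finite model contains a grid (`RCC8Structure.IsRegionStructure.exists_isGrid`). The length `m` of the
rows is not prescribed: it is existentially quantified together with the model, and any halting
computation fits if `m` is large enough.

On a grid, the rule that computes a tile from the three tiles below it is again expressible, and a
model of the whole formula is a tiling (`TileSystem.exists_isTiling_of_sat` and
`RCC8Structure.IsIntervalGrid.exists_sat`). Tilings correspond to halting computations
(`Turing.TM0.exists_isTiling_of_halts`, `Turing.TM0.halts_of_isTiling`). The machine is fixed, a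
universal one obtained from the compilation of partial recursive functions to Turing machines
(`Turing.exists_universal_machine`), so that only the input part of the formula varies with the
program, and the reduction is easily seen to be computable (`TileSystem.primrec_formula`).

That the topological structures are region structures, that is, that they respect the composition
table, is `RCC8Structure.concrete_isRegionStructure`.
-/

/-! ### Topological structures are region structures -/

namespace RCC8Structure

set_option maxHeartbeats 4000000 in
/-- Contact `C`, overlap `O`, inclusion `P` and non-tangential inclusion `N` determine the eight
relations, and the few laws listed here imply the whole composition table. -/
theorem isRegionStructure_of_mereotopology (R : RCC8Structure.{u}) [Nonempty R.W]
    (C O P N : R.W → R.W → Prop)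
    (hC : ∀ s t, C s t → C t s) (hO : ∀ s t, O s t → O t s)
    (hOC : ∀ s t, O s t → C s t) (hNP : ∀ s t, N s t → P s t) (hPO : ∀ s t, P s t → O s t)
    (hrefl : ∀ s, P s s) (hanti : ∀ s t, P s t → P t s → s = t)
    (hPP : ∀ s t r, P s t → P t r → P s r) (hPN : ∀ s t r, P s t → N t r → N s r)
    (hNP' : ∀ s t r, N s t → P t r → N s r) (hCP : ∀ s t r, C s t → P t r → C s r)
    (hOP : ∀ s t r, O s t → P t r → O s r) (hCN : ∀ s t r, C s t → N t r → O s r)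
    (hdc : ∀ s t, R.rel .dc s t ↔ ¬ C s t) (hec : ∀ s t, R.rel .ec s t ↔ ¬ O s t ∧ C s t)
    (hpo : ∀ s t, R.rel .po s t ↔ O s t ∧ ¬ P s t ∧ ¬ P t s)
    (heq : ∀ s t, R.rel .eq s t ↔ s = t)
    (htpp : ∀ s t, R.rel .tpp s t ↔ P s t ∧ ¬ N s t ∧ s ≠ t)
    (hntpp : ∀ s t, R.rel .ntpp s t ↔ N s t ∧ s ≠ t)
    (htppi : ∀ s t, R.rel .tppi s t ↔ P t s ∧ ¬ N t s ∧ t ≠ s)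
    (hntppi : ∀ s t, R.rel .ntppi s t ↔ N t s ∧ t ≠ s) : R.IsRegionStructure := by
  have hdisj : ∀ r q x y, R.rel r x y → R.rel q x y → r = q := by
    intro r q x y
    cases r <;> cases q <;>
      simp only [hdc, hec, hpo, heq, htpp, hntpp, htppi, hntppi] <;> grind
  have hexh : ∀ x y, ∃ r, R.rel r x y := by
    intro x y
    by_contra! h
    have h1 := h .dc
    have h2 := h .ec
    have h3 := h .po
    have h4 := h .eq
    have h5 := h .tpp
    have h6 := h .ntpp
    have h7 := h .tppi
    have h8 := h .ntppi
    simp only [hdc, hec, hpo, heq, htpp, hntpp, htppi, hntppi] at h1 h2 h3 h4 h5 h6 h7 h8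
    grind
  refine ⟨inferInstance, hdisj, hexh, heq, ?_, ?_⟩
  · intro r x y
    cases r <;> simp only [RCC8.inv, hdc, hec, hpo, heq, htpp, hntpp, htppi, hntppi] <;> grind
  · intro r₁ r₂ x y z h₁ h₂
    obtain ⟨q, hq⟩ := hexh x z
    refine ⟨q, ?_, hq⟩
    cases r₁ <;> cases r₂ <;> cases q <;>
      first
      | decide
      | (exfalso
         simp only [hdc, hec, hpo, heq, htpp, hntpp, htppi, hntppi] at h₁ h₂ hq
         grind)

theorem concrete_isRegionStructure {X : Type u} [TopologicalSpace X] {U : Set (Set X)}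
    (hU : U ⊆ regRegions X) (hne : U.Nonempty) : (concrete X U).IsRegionStructure := by
  have hE : ∀ s t : U, s.1 = t.1 ↔ s = t := fun s t => Subtype.ext_iff.symm
  have hint : ∀ s : U, (interior s.1).Nonempty := fun s => by
    obtain ⟨h1, h2⟩ := hU s.2
    rw [← h2] at h1
    exact closure_nonempty_iff.1 h1
  have : Nonempty (concrete X U).W := hne.to_subtype
  refine isRegionStructure_of_mereotopology (concrete X U)
    (fun s t : U => (s.1 ∩ t.1).Nonempty)
    (fun s t : U => (interior s.1 ∩ interior t.1).Nonempty) (fun s t : U => s.1 ⊆ t.1)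
    (fun s t : U => s.1 ⊆ interior t.1) ?_ ?_ ?_ ?_ ?_ ?_ ?_ ?_ ?_ ?_ ?_ ?_ ?_ ?_ ?_ ?_ ?_ ?_ ?_ ?_ ?_
  · intro s t h
    rwa [Set.inter_comm]
  · intro s t h
    rwa [Set.inter_comm]
  · exact fun s t h => h.mono (Set.inter_subset_inter interior_subset interior_subset)
  · exact fun s t h => h.trans interior_subset
  · intro s t h
    obtain ⟨x, hx⟩ := hint s
    exact ⟨x, hx, interior_mono h hx⟩
  · exact fun s => Set.Subset.refl _
  · exact fun s t h h' => Subtype.ext (Set.Subset.antisymm h h')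
  · exact fun s t r h h' => Set.Subset.trans h h'
  · exact fun s t r h h' => Set.Subset.trans h h'
  · exact fun s t r h h' => Set.Subset.trans h (interior_mono h')
  · exact fun s t r h h' => h.mono (Set.inter_subset_inter_right _ h')
  · exact fun s t r h h' => h.mono (Set.inter_subset_inter_right _ (interior_mono h'))
  · rintro s t r ⟨x, hxs, hxt⟩ h'
    -- a regular closed set that meets an open set also meets it with its interior
    rw [← (hU s.2).2] at hxs
    obtain ⟨y, hy, hy'⟩ := mem_closure_iff.1 hxs _ isOpen_interior (h' hxt)
    exact ⟨y, hy', hy⟩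
  · intro s t
    exact Set.not_nonempty_iff_eq_empty.symm
  · intro s t
    exact and_congr Set.not_nonempty_iff_eq_empty.symm Set.nonempty_iff_ne_empty.symm
  · intro s t
    exact and_congr Set.nonempty_iff_ne_empty.symm Iff.rfl
  · exact fun s t => hE s t
  · exact fun s t => and_congr Iff.rfl (and_congr Iff.rfl (not_congr (hE s t)))
  · exact fun s t => and_congr Iff.rfl (not_congr (hE s t))
  · exact fun s t => and_congr Iff.rfl (and_congr Iff.rfl (not_congr (hE t s)))
  · exact fun s t => and_congr Iff.rfl (not_congr (hE t s))

theorem IsRegionStructure.restrict {R : RCC8Structure.{u}} (hR : R.IsRegionStructure)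
    {A : Set R.W} (hA : A.Nonempty) : (R.restrict A).IsRegionStructure where
  nonempty := hA.to_subtype
  disjoint r q x y := hR.disjoint r q x.1 y.1
  exhaustive x y := hR.exhaustive x.1 y.1
  eq_iff x y := (hR.eq_iff x.1 y.1).trans Subtype.ext_iff.symm
  inv_iff r x y := hR.inv_iff r x.1 y.1
  comp r₁ r₂ x y z := hR.comp r₁ r₂ x.1 y.1 z.1

end RCC8Structure

theorem regRegions_nonempty {X : Type u} [TopologicalSpace X] [Nonempty X] :
    (regRegions X).Nonempty :=
  ⟨Set.univ, Set.univ_nonempty, by simp⟩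

theorem classTOP_subset_classRS : classTOP.{u} ⊆ classRS.{u} := by
  rintro R ⟨X, _, _, rfl⟩
  exact RCC8Structure.concrete_isRegionStructure subset_rfl regRegions_nonempty

theorem rectRegions_subset_regRegions (n : ℕ) : rectRegions n ⊆ regRegions (Fin n → ℝ) := by
  rintro s ⟨C, hC, rfl⟩
  refine ⟨Set.univ_pi_nonempty_iff.2 fun i => (hC i).2.2.nonempty, ?_⟩
  rw [interior_pi_set Set.finite_univ, closure_pi_set]
  congr 1
  funext i
  obtain ⟨hcl, hoc, a, ha, b, hb, hab⟩ := hC i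
  have hne : (interior (C i)).Nonempty := by
    wlog h : a < b generalizing a b
    · exact this b hb a ha hab.symm (lt_of_le_of_ne (not_lt.1 h) hab.symm)
    obtain ⟨c, hc⟩ := exists_between h
    exact ⟨c, interior_maximal (Set.Ioo_subset_Icc_self.trans (hoc.out ha hb)) isOpen_Ioo hc⟩
  rw [(hoc.convex (𝕜 := ℝ)).closure_interior_eq_closure_of_nonempty_interior hne, hcl.closure_eq]

theorem regStructure_mem_classRS (n : ℕ) : regStructure n ∈ classRS :=
  RCC8Structure.concrete_isRegionStructure subset_rfl regRegions_nonempty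

theorem rectStructure_mem_classRS (n : ℕ) : rectStructure n ∈ classRS :=
  RCC8Structure.concrete_isRegionStructure (rectRegions_subset_regRegions n)
    ⟨Set.univ.pi fun _ => Set.univ, fun _ => Set.univ,
      fun _ => ⟨isClosed_univ, Set.ordConnected_univ, Set.nontrivial_univ⟩, rfl⟩

/-! ### Derived connectives and the modal vocabulary of the reduction -/

namespace RCC8Formula

/-- A tautology. -/
def top : RCC8Formula := neg (and (var 0) (neg (var 0)))

/-- Implication. -/
def imp (φ ψ : RCC8Formula) : RCC8Formula := neg (and φ (neg ψ))

/-- The diamond dual to the box of a relation symbol. -/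
def dia (r : RCC8) (φ : RCC8Formula) : RCC8Formula := neg (box r (neg φ))

/-- The conjunction of a list of formulas. -/
def conj : List RCC8Formula → RCC8Formula
  | [] => top
  | φ :: l => and φ (conj l)

/-- Truth everywhere: the eight relations are jointly exhaustive, so their boxes together form a
universal modality. -/
def univ (φ : RCC8Formula) : RCC8Formula := conj (RCC8.all.map fun r => box r φ)

/-- Truth somewhere. -/
def exi (φ : RCC8Formula) : RCC8Formula := neg (univ (neg φ))

/-- `φ` holds at a cell that is linked to the current one by a connector of sort `k`, the cells
being the regions satisfying `var 0` and the connectors of sort `k` those satisfying `var k`. -/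
def fwd (k : ℕ) (φ : RCC8Formula) : RCC8Formula :=
  dia .tpp (and (var k) (dia .tpp (and (var 0) φ)))

/-- The converse of `fwd`. -/
def bwd (k : ℕ) (φ : RCC8Formula) : RCC8Formula :=
  dia .tppi (and (var k) (dia .tppi (and (var 0) φ)))

/-- There is a larger cell. -/
def hasAbove : RCC8Formula := dia .ntpp (var 0)

/-- There is a smaller cell. -/
def hasBelow : RCC8Formula := dia .ntppi (var 0)

/-- Any two distinct regions satisfying `var k` are non-tangentially nested. -/
def chainAxiom (k : ℕ) : RCC8Formula :=
  imp (var k) (conj ([RCC8.dc, .ec, .po, .tpp, .tppi].map fun r => box r (neg (var k))))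

/-- The axioms that arrange the cells in a chain on which the connectors of sort `1` link each cell
with the next one, and those of sort `2` link an initial segment with a final segment. -/
def gridAxioms : RCC8Formula :=
  univ (conj [chainAxiom 0, chainAxiom 1, chainAxiom 2,
    imp (and (var 0) hasAbove) (fwd 1 top),
    imp (and (var 0) hasBelow) (bwd 1 top),
    imp (and (var 0) (fwd 2 top)) (box .ntppi (imp (var 0) (fwd 2 top))),
    imp (and (var 0) (bwd 2 top)) (box .ntpp (imp (var 0) (bwd 2 top)))])

section Sat

variable {R : RCC8Structure.{u}} {V : ℕ → Set R.W} {s : R.W}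

@[simp] theorem sat_var {i : ℕ} : Sat R V s (var i) ↔ s ∈ V i := Iff.rfl

@[simp] theorem sat_neg {φ : RCC8Formula} : Sat R V s (neg φ) ↔ ¬ Sat R V s φ := Iff.rfl

@[simp] theorem sat_and {φ ψ : RCC8Formula} :
    Sat R V s (and φ ψ) ↔ Sat R V s φ ∧ Sat R V s ψ := Iff.rfl

@[simp] theorem sat_box {r : RCC8} {φ : RCC8Formula} :
    Sat R V s (box r φ) ↔ ∀ t, R.rel r s t → Sat R V t φ := Iff.rfl

@[simp] theorem sat_top : Sat R V s top := by simp [top]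

@[simp] theorem sat_imp {φ ψ : RCC8Formula} :
    Sat R V s (imp φ ψ) ↔ (Sat R V s φ → Sat R V s ψ) := by simp [imp]

@[simp] theorem sat_dia {r : RCC8} {φ : RCC8Formula} :
    Sat R V s (dia r φ) ↔ ∃ t, R.rel r s t ∧ Sat R V t φ := by simp [dia]

@[simp] theorem sat_conj {l : List RCC8Formula} :
    Sat R V s (conj l) ↔ ∀ φ ∈ l, Sat R V s φ := by
  induction l <;> simp_all [conj]

theorem sat_univ (hR : R.IsRegionStructure) {φ : RCC8Formula} :
    Sat R V s (univ φ) ↔ ∀ t, Sat R V t φ := by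
  simp only [univ, sat_conj, List.forall_mem_map, sat_box]
  refine ⟨fun h t => ?_, fun h r _ t _ => h t⟩
  obtain ⟨r, hr⟩ := hR.exhaustive s t
  exact h r (by cases r <;> decide) t hr

theorem sat_exi (hR : R.IsRegionStructure) {φ : RCC8Formula} :
    Sat R V s (exi φ) ↔ ∃ t, Sat R V t φ := by
  simp [exi, sat_univ hR]

end Sat

end RCC8Formula

/-! ### Chains of cells linked by connectors -/

/-- Two regions are linked by a connector from `L` if they are tangentially nested with a connector
in between. -/
def RCC8Structure.Linked (R : RCC8Structure.{u}) (L : Set R.W) (a b : R.W) : Prop :=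
  ∃ l ∈ L, R.rel .tpp a l ∧ R.rel .tpp l b

/-- A strictly monotone partial injection of an initial segment of `{0, …, N}` onto a final segment
is a shift. -/
theorem exists_shift_of_strictMono (G : ℕ → ℕ → Prop) (N : ℕ) (hb : ∀ i j, G i j → i ≤ N ∧ j ≤ N)
    (hmono : ∀ i j i' j', G i j → G i' j' → i < i' → j < j')
    (hfun : ∀ i j j', G i j → G i j' → j = j')
    (hdom : ∀ i j i', G i j → i' ≤ i → ∃ j', G i' j')
    (hrng : ∀ i j j', G i j → j ≤ j' → j' ≤ N → ∃ i', G i' j') (hgt : ∀ i j, G i j → i < j) :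
    ∃ m, 1 ≤ m ∧ ∀ i j, i ≤ N → j ≤ N → (G i j ↔ j = i + m) := by
  by_cases h0 : ∃ m, G 0 m
  · obtain ⟨m, hm⟩ := h0
    have key : ∀ i j, G i j → j = i + m := by
      intro i
      induction i with
      | zero => exact fun j hj => by rw [hfun _ _ _ hj hm, zero_add]
      | succ i ih =>
        intro j hj
        obtain ⟨k, hk⟩ := hdom _ _ i hj i.le_succ
        have h1 := ih k hk
        have h2 := hmono _ _ _ _ hk hj i.lt_succ_self
        -- the value `i + m + 1` is attained, and only an argument beyond `i` can attain it
        obtain ⟨i', hi'⟩ := hrng _ _ (i + m + 1) hm (by omega) (by have := hb _ _ hj; omega)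
        have h3 : i < i' := by
          rcases lt_trichotomy i i' with h | rfl | h
          · exact h
          · have := ih _ hi'
            omega
          · have := hmono _ _ _ _ hi' hk h
            omega
        rcases Nat.lt_or_eq_of_le h3 with h | h
        · have := hmono _ _ _ _ hj hi' h
          omega
        · rw [← h] at hi'
          rw [hfun _ _ _ hj hi']
          omega
    refine ⟨m, hgt _ _ hm, fun i j hi hj => ⟨key i j, ?_⟩⟩
    rintro rfl
    obtain ⟨i', hi'⟩ := hrng _ _ (i + m) hm (by omega) hj
    have := key _ _ hi'
    obtain rfl : i' = i := by omega
    exact hi'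
  · refine ⟨N + 1, by omega, fun i j hi hj => ⟨fun h => ?_, fun h => by omega⟩⟩
    exact absurd (hdom _ _ 0 h (Nat.zero_le _)) h0

/-- The cells (the regions satisfying `var 0`) form the chain `x 0, …, x N`; connectors of sort `1`
link `x i` with `x (i + 1)`, and connectors of sort `2` link `x i` with `x (i + m)`: read in rows of
length `m`, the chain is a grid, with the next column at `i + 1` and the next row at `i + m`. -/
structure RCC8Structure.IsGrid (R : RCC8Structure.{u}) (V : ℕ → Set R.W) (N m : ℕ) (x : ℕ → R.W) :
    Prop where
  mem_iff : ∀ w, w ∈ V 0 ↔ ∃ i ≤ N, x i = w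
  ntpp_iff : ∀ i j, i ≤ N → j ≤ N → (R.rel .ntpp (x i) (x j) ↔ i < j)
  next_iff : ∀ i j, i ≤ N → j ≤ N → (R.Linked (V 1) (x i) (x j) ↔ j = i + 1)
  up_iff : ∀ i j, i ≤ N → j ≤ N → (R.Linked (V 2) (x i) (x j) ↔ j = i + m)

/-- A finite strict linear order is enumerated by an initial segment of `ℕ`. -/
theorem exists_enumeration {α : Type*} [Finite α] [Nonempty α] (r : α → α → Prop)
    (hirr : ∀ a, ¬ r a a) (htr : ∀ a b c, r a b → r b c → r a c)
    (htot : ∀ a b, r a b ∨ a = b ∨ r b a) :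
    ∃ (N : ℕ) (x : ℕ → α), (∀ a, ∃ i ≤ N, x i = a) ∧
      ∀ i j, i ≤ N → j ≤ N → (r (x i) (x j) ↔ i < j) := by
  classical
  have := Fintype.ofFinite α
  have : IsStrictTotalOrder α r :=
    { irrefl := hirr, trans := htr, trichotomous := fun a b h1 h2 => by
        rcases htot a b with h | h | h
        · exact absurd h h1
        · exact h
        · exact absurd h h2 }
  let _ := linearOrderOfSTO r
  obtain ⟨N, hN⟩ := Nat.exists_eq_succ_of_ne_zero (Fintype.card_ne_zero (α := α))
  let e := Fintype.orderIsoFinOfCardEq α hN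
  refine ⟨N, fun i => e (Fin.ofNat (N + 1) i), fun a => ?_, fun i j hi hj => ?_⟩
  · refine ⟨(e.symm a).1, Nat.lt_succ_iff.1 (e.symm a).2, ?_⟩
    have : Fin.ofNat (N + 1) (e.symm a).1 = e.symm a := by
      ext
      simp
    simp only [this, e.apply_symm_apply]
  · have h : e (Fin.ofNat (N + 1) i) < e (Fin.ofNat (N + 1) j) ↔ i < j := by
      rw [e.lt_iff_lt, Fin.lt_def]
      simp [Nat.mod_eq_of_lt (Nat.lt_succ_of_le hi), Nat.mod_eq_of_lt (Nat.lt_succ_of_le hj)]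
    exact h

namespace RCC8Structure

variable {R : RCC8Structure.{u}}

theorem IsRegionStructure.comp_eq (hR : R.IsRegionStructure) {r₁ r₂ q : RCC8} {a b c : R.W}
    (hc : RCC8.comp r₁ r₂ = [q]) (h₁ : R.rel r₁ a b) (h₂ : R.rel r₂ b c) : R.rel q a c := by
  obtain ⟨p, hp, h⟩ := hR.comp r₁ r₂ a b c h₁ h₂
  rw [hc, List.mem_singleton] at hp
  rwa [← hp]

/-- The regions in `E` are pairwise non-tangentially nested. -/
def IsChain (R : RCC8Structure.{u}) (E : Set R.W) : Prop :=
  ∀ a ∈ E, ∀ b ∈ E, R.rel .ntpp a b ∨ a = b ∨ R.rel .ntpp b a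

theorem IsRegionStructure.not_ntpp_self (hR : R.IsRegionStructure) (a : R.W) :
    ¬ R.rel .ntpp a a := fun h => by
  cases hR.disjoint _ _ _ _ h ((hR.eq_iff a a).2 rfl)

/-- Below and above a fixed connector there is room for only one cell, because a tangential step
composed with a non-tangential one is non-tangential. This makes the link relation a strictly
monotone partial function. -/
theorem IsRegionStructure.linked_mono (hR : R.IsRegionStructure) {E L : Set R.W}
    (hE : R.IsChain E) (hL : R.IsChain L) {a b a' b' : R.W} (hb : b ∈ E) (hb' : b' ∈ E)
    (h : R.Linked L a b) (h' : R.Linked L a' b') (haa : R.rel .ntpp a a') : R.rel .ntpp b b' := by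
  obtain ⟨l, hl, h1, h2⟩ := h
  obtain ⟨l', hl', h1', h2'⟩ := h'
  have hne : ∀ {c d : R.W}, R.rel .tpp c d → ¬ R.rel .ntpp c d := fun hc hd => by
    cases hR.disjoint _ _ _ _ hc hd
  have hll : R.rel .ntpp l l' := by
    rcases hL l hl l' hl' with hll | rfl | hll
    · exact hll
    · exact absurd (hR.comp_eq rfl haa h1') (hne h1)
    · exact absurd (hR.comp_eq rfl haa (hR.comp_eq rfl h1' hll)) (hne h1)
  have hlb : R.rel .ntpp l b' := hR.comp_eq rfl hll h2'
  rcases hE b hb b' hb' with hbb | rfl | hbb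
  · exact hbb
  · exact absurd hlb (hne h2)
  · exact absurd (hR.comp_eq rfl hlb hbb) (hne h2)

theorem IsRegionStructure.linked_unique (hR : R.IsRegionStructure) {E L : Set R.W}
    (hE : R.IsChain E) (hL : R.IsChain L) {a b b' : R.W} (hb : b ∈ E) (hb' : b' ∈ E)
    (h : R.Linked L a b) (h' : R.Linked L a b') : b = b' := by
  obtain ⟨l, hl, h1, h2⟩ := h
  obtain ⟨l', hl', h1', h2'⟩ := h'
  have hne : ∀ {c d : R.W}, R.rel .tpp c d → ¬ R.rel .ntpp c d := fun hc hd => by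
    cases hR.disjoint _ _ _ _ hc hd
  obtain rfl : l = l' := by
    rcases hL l hl l' hl' with hll | hll | hll
    · exact absurd (hR.comp_eq rfl h1 hll) (hne h1')
    · exact hll
    · exact absurd (hR.comp_eq rfl h1' hll) (hne h1)
  rcases hE b hb b' hb' with hbb | hbb | hbb
  · exact absurd (hR.comp_eq rfl h2 hbb) (hne h2')
  · exact hbb
  · exact absurd (hR.comp_eq rfl h2' hbb) (hne h2)

theorem IsRegionStructure.linked_ntpp (hR : R.IsRegionStructure) {E L : Set R.W}
    (hE : R.IsChain E) {a b : R.W} (ha : a ∈ E) (hb : b ∈ E) (h : R.Linked L a b) :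
    R.rel .ntpp a b := by
  obtain ⟨l, hl, h1, h2⟩ := h
  obtain ⟨q, hq, hab⟩ := hR.comp _ _ _ _ _ h1 h2
  rcases hE a ha b hb with h | rfl | h
  · exact h
  · have := hR.disjoint _ _ _ _ hab ((hR.eq_iff a a).2 rfl)
    simp [RCC8.comp, this] at hq
  · have := hR.disjoint _ _ _ _ hab ((hR.inv_iff .ntpp _ _).1 h)
    simp [RCC8.comp, RCC8.inv, this] at hq

theorem sat_fwd {V : ℕ → Set R.W} {s : R.W} {k : ℕ}
    {φ : RCC8Formula} : (RCC8Formula.fwd k φ).Sat R V s ↔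
      ∃ t ∈ V 0, R.Linked (V k) s t ∧ φ.Sat R V t := by
  simp only [RCC8Formula.fwd, RCC8Formula.sat_dia, RCC8Formula.sat_and, RCC8Formula.sat_var, Linked]
  grind

theorem IsRegionStructure.sat_bwd (hR : R.IsRegionStructure) {V : ℕ → Set R.W} {s : R.W} {k : ℕ}
    {φ : RCC8Formula} : (RCC8Formula.bwd k φ).Sat R V s ↔
      ∃ t ∈ V 0, R.Linked (V k) t s ∧ φ.Sat R V t := by
  have hinv : ∀ a b, R.rel .tppi a b ↔ R.rel .tpp b a := fun a b => hR.inv_iff .tppi a b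
  simp only [RCC8Formula.bwd, RCC8Formula.sat_dia, RCC8Formula.sat_and, RCC8Formula.sat_var, Linked,
    hinv]
  grind

theorem IsRegionStructure.sat_chainAxiom (hR : R.IsRegionStructure) {V : ℕ → Set R.W} {k : ℕ} :
    (∀ s, (RCC8Formula.chainAxiom k).Sat R V s) ↔ R.IsChain (V k) := by
  simp only [RCC8Formula.chainAxiom, RCC8Formula.sat_imp, RCC8Formula.sat_var,
    RCC8Formula.sat_conj, List.forall_mem_map, RCC8Formula.sat_box, RCC8Formula.sat_neg]
  refine ⟨fun h a ha b hb => ?_, fun h a ha r hr b hab hb => ?_⟩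
  · obtain ⟨r, hr⟩ := hR.exhaustive a b
    have h' : r ∉ [RCC8.dc, .ec, .po, .tpp, .tppi] := fun hm => h a ha r hm b hr hb
    cases r
    case eq => exact Or.inr (Or.inl ((hR.eq_iff a b).1 hr))
    case ntpp => exact Or.inl hr
    case ntppi => exact Or.inr (Or.inr ((hR.inv_iff .ntppi a b).1 hr))
    all_goals exact absurd (by decide) h'
  · rcases h a ha b hb with h | h | h
    · rw [hR.disjoint _ _ _ _ hab h] at hr
      exact absurd hr (by decide)
    · rw [hR.disjoint _ _ _ _ hab ((hR.eq_iff a b).2 h)] at hr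
      exact absurd hr (by decide)
    · rw [hR.disjoint _ _ _ _ hab ((hR.inv_iff .ntpp b a).1 h)] at hr
      exact absurd hr (by decide)

end RCC8Structure

namespace RCC8Structure

open RCC8Formula

variable {R : RCC8Structure.{u}} {V : ℕ → Set R.W}

theorem IsRegionStructure.sat_gridAxioms (hR : R.IsRegionStructure) (s : R.W) :
    gridAxioms.Sat R V s ↔ (R.IsChain (V 0) ∧ R.IsChain (V 1) ∧ R.IsChain (V 2)) ∧
      (∀ a ∈ V 0, ∀ b ∈ V 0, R.rel .ntpp a b → ∃ c ∈ V 0, R.Linked (V 1) a c) ∧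
      (∀ a ∈ V 0, ∀ b ∈ V 0, R.rel .ntpp b a → ∃ c ∈ V 0, R.Linked (V 1) c a) ∧
      (∀ a ∈ V 0, ∀ b ∈ V 0, R.Linked (V 2) a b → ∀ a' ∈ V 0, R.rel .ntpp a' a →
        ∃ c ∈ V 0, R.Linked (V 2) a' c) ∧
      (∀ a ∈ V 0, ∀ b ∈ V 0, R.Linked (V 2) b a → ∀ a' ∈ V 0, R.rel .ntpp a a' →
        ∃ c ∈ V 0, R.Linked (V 2) c a') := by
  have hinv : ∀ a b, R.rel .ntppi a b ↔ R.rel .ntpp b a := fun a b => hR.inv_iff .ntppi a b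
  rw [gridAxioms, sat_univ hR, ← hR.sat_chainAxiom, ← hR.sat_chainAxiom, ← hR.sat_chainAxiom]
  simp only [sat_conj, List.forall_mem_cons, sat_imp, sat_and, sat_var, hasAbove, hasBelow, sat_dia,
    sat_fwd, hR.sat_bwd, sat_top, sat_box, hinv, forall_and, List.not_mem_nil, and_true,
    false_imp_iff, implies_true]
  grind

theorem IsRegionStructure.exists_isGrid (hR : R.IsRegionStructure) [Finite R.W] {s : R.W}
    (hs : gridAxioms.Sat R V s) (hne : (V 0).Nonempty) :
    ∃ N m x, 1 ≤ m ∧ R.IsGrid V N m x := by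
  obtain ⟨⟨h0, h1, h2⟩, hn, hp, hd, hr⟩ := (hR.sat_gridAxioms s).1 hs
  have : Nonempty (V 0) := hne.to_subtype
  obtain ⟨N, x, hx, hlt⟩ := exists_enumeration (fun a b : V 0 => R.rel .ntpp a.1 b.1)
    (fun a => hR.not_ntpp_self a.1) (fun a b c h h' => hR.comp_eq rfl h h')
    (fun a b => by
      rcases h0 a.1 a.2 b.1 b.2 with h | h | h
      · exact Or.inl h
      · exact Or.inr (Or.inl (Subtype.ext h))
      · exact Or.inr (Or.inr h))
  have hx' : ∀ a ∈ V 0, ∃ i ≤ N, (x i).1 = a := fun a ha => by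
    obtain ⟨i, hi, h⟩ := hx ⟨a, ha⟩
    exact ⟨i, hi, by rw [h]⟩
  have hinj : ∀ i j, i ≤ N → j ≤ N → (x i).1 = (x j).1 → i = j := fun i j hi hj h => by
    by_contra hij
    rcases lt_or_gt_of_ne hij with hij | hij
    · exact hR.not_ntpp_self _ (h ▸ (hlt i j hi hj).2 hij)
    · exact hR.not_ntpp_self _ (h ▸ (hlt j i hj hi).2 hij)
  -- a link relation satisfying the closure conditions is a shift of indices
  have shift : ∀ L : Set R.W, R.IsChain L →
      (∀ a ∈ V 0, ∀ b ∈ V 0, R.Linked L a b → ∀ a' ∈ V 0, R.rel .ntpp a' a →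
        ∃ c ∈ V 0, R.Linked L a' c) →
      (∀ a ∈ V 0, ∀ b ∈ V 0, R.Linked L b a → ∀ a' ∈ V 0, R.rel .ntpp a a' →
        ∃ c ∈ V 0, R.Linked L c a') →
      ∃ m, 1 ≤ m ∧ ∀ i j, i ≤ N → j ≤ N → (R.Linked L (x i).1 (x j).1 ↔ j = i + m) := by
    intro L hL hd hr
    obtain ⟨m, hm, h⟩ := exists_shift_of_strictMono
      (fun i j => i ≤ N ∧ j ≤ N ∧ R.Linked L (x i).1 (x j).1) N
      (fun i j h => ⟨h.1, h.2.1⟩)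
      (fun i j i' j' h h' hii => (hlt _ _ h.2.1 h'.2.1).1
        (hR.linked_mono h0 hL (x j).2 (x j').2 h.2.2 h'.2.2 ((hlt _ _ h.1 h'.1).2 hii)))
      (fun i j j' h h' => hinj _ _ h.2.1 h'.2.1
        (hR.linked_unique h0 hL (x j).2 (x j').2 h.2.2 h'.2.2))
      (fun i j i' h hii => by
        rcases Nat.lt_or_eq_of_le hii with hii | rfl
        · obtain ⟨c, hc, hl⟩ := hd _ (x i).2 _ (x j).2 h.2.2 _ (x i').2
            ((hlt _ _ (by omega) h.1).2 hii)
          obtain ⟨k, hk, rfl⟩ := hx' c hc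
          exact ⟨k, by omega, hk, hl⟩
        · exact ⟨j, h⟩)
      (fun i j j' h hjj hj' => by
        rcases Nat.lt_or_eq_of_le hjj with hjj | rfl
        · obtain ⟨c, hc, hl⟩ := hr _ (x j).2 _ (x i).2 h.2.2 _ (x j').2
            ((hlt _ _ h.2.1 hj').2 hjj)
          obtain ⟨k, hk, rfl⟩ := hx' c hc
          exact ⟨k, hk, hj', hl⟩
        · exact ⟨i, h⟩)
      (fun i j h => (hlt _ _ h.1 h.2.1).1 (hR.linked_ntpp h0 (x i).2 (x j).2 h.2.2))
    refine ⟨m, hm, fun i j hi hj => ?_⟩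
    rw [← h i j hi hj]
    exact ⟨fun h => ⟨hi, hj, h⟩, fun h => h.2.2⟩
  obtain ⟨m, hm, hup⟩ := shift (V 2) h2 hd hr
  obtain ⟨k, hk, hnext⟩ := shift (V 1) h1
    (fun a ha b hb h a' ha' hlt => hn a' ha' a ha hlt)
    (fun a ha b hb h a' ha' hlt => hp a' ha' a ha hlt)
  refine ⟨N, m, fun i => (x i).1, hm, ⟨fun w => ⟨hx' w, ?_⟩, hlt, fun i j hi hj => ?_, hup⟩⟩
  · rintro ⟨i, -, rfl⟩
    exact (x i).2
  · rw [hnext i j hi hj]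
    -- the second cell is linked to some earlier one, so the shift is by one
    have hk1 : 1 ≤ N → k = 1 := fun hN => by
      obtain ⟨c, hc, hl⟩ := hp _ (x 1).2 _ (x 0).2 ((hlt 0 1 (by omega) hN).2 one_pos)
      obtain ⟨l, hl', rfl⟩ := hx' c hc
      have := (hnext l 1 hl' hN).1 hl
      omega
    omega

theorem IsGrid.sat_gridAxioms {N m : ℕ} {x : ℕ → R.W} (hR : R.IsRegionStructure)
    (h : R.IsGrid V N m x) (h1 : R.IsChain (V 1)) (h2 : R.IsChain (V 2)) (s : R.W) :
    gridAxioms.Sat R V s := by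
  rw [hR.sat_gridAxioms s]
  simp only [h.mem_iff]
  refine ⟨⟨?_, h1, h2⟩, ?_, ?_, ?_, ?_⟩
  · intro a ha b hb
    obtain ⟨i, hi, rfl⟩ := (h.mem_iff a).1 ha
    obtain ⟨j, hj, rfl⟩ := (h.mem_iff b).1 hb
    rw [h.ntpp_iff i j hi hj, h.ntpp_iff j i hj hi]
    rcases lt_trichotomy i j with hij | rfl | hij
    · exact Or.inl hij
    · exact Or.inr (Or.inl rfl)
    · exact Or.inr (Or.inr hij)
  · rintro _ ⟨i, hi, rfl⟩ _ ⟨j, hj, rfl⟩ hij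
    rw [h.ntpp_iff i j hi hj] at hij
    exact ⟨_, ⟨i + 1, by omega, rfl⟩, (h.next_iff i (i + 1) hi (by omega)).2 rfl⟩
  · rintro _ ⟨i, hi, rfl⟩ _ ⟨j, hj, rfl⟩ hij
    rw [h.ntpp_iff j i hj hi] at hij
    exact ⟨_, ⟨i - 1, by omega, rfl⟩, (h.next_iff (i - 1) i (by omega) hi).2 (by omega)⟩
  · rintro _ ⟨i, hi, rfl⟩ _ ⟨j, hj, rfl⟩ hij _ ⟨k, hk, rfl⟩ hlt
    rw [h.up_iff i j hi hj] at hij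
    rw [h.ntpp_iff k i hk hi] at hlt
    exact ⟨_, ⟨k + m, by omega, rfl⟩, (h.up_iff k (k + m) hk (by omega)).2 rfl⟩
  · rintro _ ⟨i, hi, rfl⟩ _ ⟨j, hj, rfl⟩ hij _ ⟨k, hk, rfl⟩ hlt
    rw [h.up_iff j i hj hi] at hij
    rw [h.ntpp_iff i k hi hk] at hlt
    exact ⟨_, ⟨k - m, by omega, rfl⟩, (h.up_iff (k - m) k (by omega) hk).2 (by omega)⟩

namespace IsGrid

variable {N m : ℕ} {x : ℕ → R.W}

theorem mem (h : R.IsGrid V N m x) {i : ℕ} (hi : i ≤ N) : x i ∈ V 0 := (h.mem_iff _).2 ⟨i, hi, rfl⟩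

theorem sat_next (h : R.IsGrid V N m x) {i : ℕ} (hi : i ≤ N) {φ : RCC8Formula} :
    (fwd 1 φ).Sat R V (x i) ↔ i + 1 ≤ N ∧ φ.Sat R V (x (i + 1)) := by
  simp only [sat_fwd, h.mem_iff]
  refine ⟨?_, fun ⟨h1, h2⟩ => ⟨_, ⟨_, h1, rfl⟩, (h.next_iff _ _ hi h1).2 rfl, h2⟩⟩
  rintro ⟨_, ⟨j, hj, rfl⟩, hl, hφ⟩
  obtain rfl := (h.next_iff _ _ hi hj).1 hl
  exact ⟨hj, hφ⟩

theorem sat_prev (h : R.IsGrid V N m x) (hR : R.IsRegionStructure) {i : ℕ} (hi : i ≤ N)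
    {φ : RCC8Formula} :
    (bwd 1 φ).Sat R V (x i) ↔ 1 ≤ i ∧ φ.Sat R V (x (i - 1)) := by
  simp only [hR.sat_bwd, h.mem_iff]
  refine ⟨?_, fun ⟨h1, h2⟩ => ⟨_, ⟨i - 1, by omega, rfl⟩,
    (h.next_iff _ _ (by omega) hi).2 (by omega), h2⟩⟩
  rintro ⟨_, ⟨j, hj, rfl⟩, hl, hφ⟩
  obtain rfl := (h.next_iff _ _ hj hi).1 hl
  exact ⟨by omega, hφ⟩

theorem sat_up (h : R.IsGrid V N m x) {i : ℕ} (hi : i ≤ N) {φ : RCC8Formula} :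
    (fwd 2 φ).Sat R V (x i) ↔ i + m ≤ N ∧ φ.Sat R V (x (i + m)) := by
  simp only [sat_fwd, h.mem_iff]
  refine ⟨?_, fun ⟨h1, h2⟩ => ⟨_, ⟨_, h1, rfl⟩, (h.up_iff _ _ hi h1).2 rfl, h2⟩⟩
  rintro ⟨_, ⟨j, hj, rfl⟩, hl, hφ⟩
  obtain rfl := (h.up_iff _ _ hi hj).1 hl
  exact ⟨hj, hφ⟩

theorem sat_down (h : R.IsGrid V N m x) (hR : R.IsRegionStructure) {i : ℕ} (hi : i ≤ N)
    {φ : RCC8Formula} :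
    (bwd 2 φ).Sat R V (x i) ↔ m ≤ i ∧ φ.Sat R V (x (i - m)) := by
  simp only [hR.sat_bwd, h.mem_iff]
  refine ⟨?_, fun ⟨h1, h2⟩ => ⟨_, ⟨i - m, by omega, rfl⟩,
    (h.up_iff _ _ (by omega) hi).2 (by omega), h2⟩⟩
  rintro ⟨_, ⟨j, hj, rfl⟩, hl, hφ⟩
  obtain rfl := (h.up_iff _ _ hj hi).1 hl
  refine ⟨by omega, ?_⟩
  rwa [Nat.add_sub_cancel]

theorem sat_hasBelow (h : R.IsGrid V N m x) (hR : R.IsRegionStructure) {i : ℕ} (hi : i ≤ N) :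
    hasBelow.Sat R V (x i) ↔ 1 ≤ i := by
  simp only [hasBelow, sat_dia, sat_var, h.mem_iff]
  constructor
  · rintro ⟨_, hr, j, hj, rfl⟩
    have := (h.ntpp_iff j i hj hi).1 ((hR.inv_iff .ntppi _ _).1 hr)
    omega
  · exact fun h1 => ⟨_, (hR.inv_iff .ntppi _ _).2 ((h.ntpp_iff 0 i (by omega) hi).2 (by omega)),
      0, by omega, rfl⟩

theorem sat_below (h : R.IsGrid V N m x) (hR : R.IsRegionStructure) {i : ℕ} (hi : i ≤ N)
    {φ : RCC8Formula} :
    (box .ntppi (imp (var 0) φ)).Sat R V (x i) ↔ ∀ j < i, φ.Sat R V (x j) := by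
  simp only [sat_box, sat_imp, sat_var, h.mem_iff]
  constructor
  · exact fun hb j hj => hb _ ((hR.inv_iff .ntppi _ _).2
      ((h.ntpp_iff j i (by omega) hi).2 hj)) ⟨j, by omega, rfl⟩
  · rintro hb _ hr ⟨j, hj, rfl⟩
    exact hb j ((h.ntpp_iff j i hj hi).1 ((hR.inv_iff .ntppi _ _).1 hr))

theorem sat_above (h : R.IsGrid V N m x) {i : ℕ} (hi : i ≤ N) {φ : RCC8Formula} :
    (box .ntpp (imp (var 0) φ)).Sat R V (x i) ↔ ∀ j, i < j → j ≤ N → φ.Sat R V (x j) := by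
  simp only [sat_box, sat_imp, sat_var, h.mem_iff]
  constructor
  · exact fun hb j hij hj => hb _ ((h.ntpp_iff i j hi hj).2 hij) ⟨j, hj, rfl⟩
  · rintro hb _ hr ⟨j, hj, rfl⟩
    exact hb j ((h.ntpp_iff i j hi hj).1 hr) hj

end IsGrid

end RCC8Structure

/-! ### Tilings and the formulas that describe them -/

/-- A deterministic tiling system: the tile above a cell is computed by `next` from the tiles at its
left neighbour, at the cell and at its right neighbour. Rows are separated by the tile `edge`. -/
structure TileSystem (Θ : Type*) where
  /-- the separator of rows -/
  edge : Θ
  /-- the tile filling the first row outside the input -/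
  blank : Θ
  /-- the tile above a cell -/
  next : Θ → Θ → Θ → Θ
  /-- the tiles of which one has to occur -/
  goal : Set Θ

namespace TileSystem

variable {Θ : Type*} (T : TileSystem Θ)

/-- The tiles `τ 0, …, τ N`, read in rows of length `m`, form a space-time diagram of the tiling
system with input `L` written from column `s` of the first row. The last row may be incomplete. -/
structure IsTiling (L : List Θ) (N m s : ℕ) (τ : ℕ → Θ) : Prop where
  start_pos : 1 ≤ s
  fits : s + L.length < m
  fits' : s + L.length ≤ N
  edge_zero : τ 0 = T.edge
  edge_up : m ≤ N → τ m = T.edge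
  before : ∀ j, 1 ≤ j → j < s → τ j = T.blank
  input : ∀ j θ, L[j]? = some θ → τ (s + j) = θ
  after : ∀ j, s + L.length ≤ j → j < m → j ≤ N → τ j = T.blank
  step : ∀ i, 1 ≤ i → i + m ≤ N → τ (i + m) = T.next (τ (i - 1)) (τ i) (τ (i + 1))
  goal : ∃ i ≤ N, τ i ∈ T.goal

open RCC8Formula

variable [Fintype Θ]

/-- The propositional variable standing for a tile. -/
noncomputable def tile (θ : Θ) : RCC8Formula := var (3 + Fintype.equivFin Θ θ)

open Classical in
/-- Every cell carries exactly one tile. -/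
noncomputable def tileAxioms (Θ : Type*) [Fintype Θ] : RCC8Formula :=
  univ (imp (var 0) (and
    (neg (conj ((Finset.univ : Finset Θ).toList.map fun θ => neg (tile θ))))
    (conj ((Finset.univ : Finset (Θ × Θ)).toList.map fun p =>
      imp (and (tile p.1) (tile p.2)) (if p.1 = p.2 then top else neg top)))))

/-- The local rules of the tiling system: the first cell and the cell above it are edges, and every
other tile in a higher row is determined by three tiles below it. The dual `neg (fwd 2 (neg φ))`
says that `φ` holds at the cell above, if there is one; the last row may have no cells above it. -/
noncomputable def ruleAxioms : RCC8Formula :=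
  univ (imp (var 0) (and
    (imp (neg hasBelow) (and (tile T.edge) (neg (fwd 2 (neg (tile T.edge))))))
    (conj ((Finset.univ : Finset (Θ × Θ × Θ)).toList.map fun p =>
      imp (and (bwd 1 (tile p.1)) (and (tile p.2.1) (fwd 1 (tile p.2.2))))
        (neg (fwd 2 (neg (tile (T.next p.1 p.2.1 p.2.2)))))))))

/-- From the current cell on, the first row consists of the given word and blanks; a cell is in the
first row if there is no cell below it. -/
noncomputable def word : List Θ → RCC8Formula
  | [] => and (neg (bwd 2 top)) (and (tile T.blank)
      (box .ntpp (imp (var 0) (imp (neg (bwd 2 top)) (tile T.blank)))))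
  | θ :: l => and (tile θ) (fwd 1 (word l))

/-- The first row is as prescribed, and the input starts at the current cell. -/
noncomputable def start (L : List Θ) : RCC8Formula :=
  and (var 0) (and hasBelow (and (box .ntppi (imp (var 0) (imp hasBelow (tile T.blank))))
    (T.word L)))

open Classical in
/-- Some goal tile occurs. -/
noncomputable def reachesGoal : RCC8Formula :=
  exi (and (var 0) (neg (conj (T.goal.toFinset.toList.map fun θ => neg (tile θ)))))

/-- The formula describing the tilings with input `L`. -/
noncomputable def formula (L : List Θ) : RCC8Formula :=
  and (and gridAxioms (and (tileAxioms Θ) (and T.ruleAxioms T.reachesGoal))) (exi (T.start L))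

section

variable {R : RCC8Structure.{u}} {V : ℕ → Set R.W}

theorem sat_tileAxioms (hR : R.IsRegionStructure) {s : R.W} :
    (tileAxioms Θ).Sat R V s ↔ ∀ w ∈ V 0, ∃! θ : Θ, (tile θ).Sat R V w := by
  rw [tileAxioms, sat_univ hR]
  refine forall_congr' fun w => ?_
  rw [sat_imp]
  refine imp_congr Iff.rfl ?_
  simp only [sat_and, sat_neg, sat_conj, List.forall_mem_map, Finset.mem_toList, Finset.mem_univ,
    true_imp_iff, Prod.forall, sat_imp, not_forall, not_not]
  constructor
  · rintro ⟨⟨θ, hθ⟩, hu⟩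
    refine ⟨θ, hθ, fun θ' hθ' => ?_⟩
    by_contra hne
    have := hu _ _ ⟨hθ', hθ⟩
    rw [if_neg hne] at this
    exact this sat_top
  · rintro ⟨θ, hθ, hu⟩
    refine ⟨⟨θ, hθ⟩, fun a b hab => ?_⟩
    rw [hu a hab.1, hu b hab.2, if_pos rfl]
    exact sat_top

variable {N m : ℕ} {x : ℕ → R.W} {τ : ℕ → Θ}

theorem sat_ruleAxioms (hR : R.IsRegionStructure) (h : R.IsGrid V N m x) (hm : 1 ≤ m)
    (hτ : ∀ i ≤ N, ∀ θ, (tile θ).Sat R V (x i) ↔ τ i = θ) {s : R.W} :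
    T.ruleAxioms.Sat R V s ↔ τ 0 = T.edge ∧ (m ≤ N → τ m = T.edge) ∧
      ∀ i, 1 ≤ i → i + m ≤ N → τ (i + m) = T.next (τ (i - 1)) (τ i) (τ (i + 1)) := by
  rw [ruleAxioms, sat_univ hR]
  simp only [sat_imp, sat_var, h.mem_iff, forall_exists_index, and_imp, sat_and, sat_conj,
    List.forall_mem_map, Finset.mem_toList, Finset.mem_univ, true_imp_iff, Prod.forall,
    sat_neg]
  constructor
  · intro hs
    obtain ⟨h0, h1⟩ := (hs _ 0 (Nat.zero_le _) rfl).1 (by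
      rw [h.sat_hasBelow hR (Nat.zero_le _)]
      omega)
    rw [hτ 0 (Nat.zero_le _)] at h0
    refine ⟨h0, fun hmN => ?_, fun i hi hN => ?_⟩
    · rw [h.sat_up (Nat.zero_le _), zero_add, sat_neg, hτ m hmN] at h1
      exact by_contra fun hne => h1 ⟨hmN, hne⟩
    · have := (hs _ i (by omega) rfl).2 (τ (i - 1)) (τ i) (τ (i + 1)) (by
          rw [h.sat_prev hR (by omega), hτ _ (by omega)]
          exact ⟨hi, rfl⟩) (by rw [hτ _ (by omega)]) (by
          rw [h.sat_next (by omega), hτ _ (by omega)]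
          exact ⟨by omega, rfl⟩)
      rw [h.sat_up (by omega), sat_neg, hτ _ hN] at this
      exact by_contra fun hne => this ⟨hN, hne⟩
  · rintro ⟨h0, h1, h2⟩ _ i hi rfl
    rw [h.sat_hasBelow hR hi, h.sat_up hi, hτ i hi]
    refine ⟨fun hi0 => ?_, fun a b c => ?_⟩
    · obtain rfl : i = 0 := by omega
      refine ⟨h0, ?_⟩
      rintro ⟨hmN, hne⟩
      rw [sat_neg, hτ _ hmN, zero_add] at hne
      exact hne (h1 (by omega))
    · rw [h.sat_prev hR hi, h.sat_next hi, h.sat_up hi]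
      rintro ⟨hi1, ha⟩ hb ⟨hi2, hc⟩ ⟨hmN, hne⟩
      rw [hτ _ (by omega)] at ha hb hc
      rw [sat_neg, hτ _ hmN, ← ha, ← hb, ← hc] at hne
      exact hne (h2 i hi1 hmN)

theorem sat_word (hR : R.IsRegionStructure) (h : R.IsGrid V N m x)
    (hτ : ∀ i ≤ N, ∀ θ, (tile θ).Sat R V (x i) ↔ τ i = θ) (L : List Θ) {i : ℕ} (hi : i ≤ N) :
    (T.word L).Sat R V (x i) ↔ i + L.length < m ∧ i + L.length ≤ N ∧
      (∀ j θ, L[j]? = some θ → τ (i + j) = θ) ∧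
      ∀ j, i + L.length ≤ j → j < m → j ≤ N → τ j = T.blank := by
  induction L generalizing i with
  | nil =>
    simp only [word, sat_and, sat_neg, h.sat_down hR hi, sat_top, and_true, hτ i hi,
      h.sat_above hi, sat_imp, List.length_nil, add_zero, not_le]
    constructor
    · rintro ⟨h1, h2, h3⟩
      refine ⟨h1, hi, by simp, fun j hij hjm hjN => ?_⟩
      rcases Nat.lt_or_eq_of_le hij with hij | rfl
      · have := h3 j hij hjN (by
          rw [h.sat_down hR hjN]
          omega)
        rwa [hτ j hjN] at this
      · exact h2
    · rintro ⟨h1, -, -, h3⟩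
      refine ⟨h1, h3 i le_rfl h1 hi, fun j hij hjN hd => ?_⟩
      rw [h.sat_down hR hjN] at hd
      rw [hτ j hjN]
      exact h3 j hij.le (by simpa using hd) hjN
  | cons θ l ih =>
    simp only [word, sat_and, h.sat_next hi, hτ i hi, List.length_cons]
    constructor
    · rintro ⟨h1, h2, h3⟩
      obtain ⟨h4, h5, h6, h7⟩ := (ih h2).1 h3
      refine ⟨by omega, by omega, ?_, fun j hj => h7 j (by omega)⟩
      rintro (_ | j) θ' hθ'
      · simpa [h1] using hθ'
      · rw [← h6 j θ' (by simpa using hθ')]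
        congr 1
        omega
    · rintro ⟨h4, h5, h6, h7⟩
      refine ⟨by simpa using h6 0 θ (by simp), by omega, (ih (by omega)).2 ⟨by omega, by omega,
        fun j θ' hθ' => ?_, fun j hj => h7 j (by omega)⟩⟩
      rw [← h6 (j + 1) θ' (by simpa using hθ')]
      congr 1
      omega

theorem sat_start (hR : R.IsRegionStructure) (h : R.IsGrid V N m x)
    (hτ : ∀ i ≤ N, ∀ θ, (tile θ).Sat R V (x i) ↔ τ i = θ) (L : List Θ) {i : ℕ} (hi : i ≤ N) :
    (T.start L).Sat R V (x i) ↔ 1 ≤ i ∧ (∀ j, 1 ≤ j → j < i → τ j = T.blank) ∧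
      i + L.length < m ∧ i + L.length ≤ N ∧ (∀ j θ, L[j]? = some θ → τ (i + j) = θ) ∧
      ∀ j, i + L.length ≤ j → j < m → j ≤ N → τ j = T.blank := by
  rw [start, sat_and, sat_and, sat_and, T.sat_word hR h hτ L hi, h.sat_below hR hi,
    h.sat_hasBelow hR hi, sat_var, iff_true_intro (h.mem hi), true_and]
  refine and_congr Iff.rfl (and_congr ?_ Iff.rfl)
  refine ⟨fun hb j h1 hj => ?_, fun hb j hj => ?_⟩
  · have := hb j hj
    rw [sat_imp, h.sat_hasBelow hR (by omega), hτ j (by omega)] at this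
    exact this h1
  · rw [sat_imp, h.sat_hasBelow hR (by omega), hτ j (by omega)]
    exact fun h1 => hb j h1 hj

theorem sat_reachesGoal (hR : R.IsRegionStructure) (h : R.IsGrid V N m x)
    (hτ : ∀ i ≤ N, ∀ θ, (tile θ).Sat R V (x i) ↔ τ i = θ) {s : R.W} :
    T.reachesGoal.Sat R V s ↔ ∃ i ≤ N, τ i ∈ T.goal := by
  rw [reachesGoal, sat_exi hR]
  simp only [sat_and, sat_var, h.mem_iff, sat_neg, sat_conj, List.forall_mem_map,
    Finset.mem_toList, Set.mem_toFinset, not_forall, not_not]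
  constructor
  · rintro ⟨_, ⟨i, hi, rfl⟩, θ, hθ, ht⟩
    rw [hτ i hi] at ht
    exact ⟨i, hi, ht ▸ hθ⟩
  · rintro ⟨i, hi, hθ⟩
    exact ⟨_, ⟨i, hi, rfl⟩, τ i, hθ, (hτ i hi _).2 rfl⟩

/-- A finite model of the formula contains a tiling. -/
theorem exists_isTiling_of_sat (hR : R.IsRegionStructure) [Finite R.W] {L : List Θ} {s : R.W}
    (hs : (T.formula L).Sat R V s) : ∃ N m s τ, T.IsTiling L N m s τ := by
  obtain ⟨⟨hg, ht, hr, hgoal⟩, hst⟩ := hs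
  rw [sat_exi hR] at hst
  obtain ⟨w, hw⟩ := hst
  have hw0 : w ∈ V 0 := hw.1
  obtain ⟨N, m, x, hm, h⟩ := hR.exists_isGrid hg ⟨w, hw0⟩
  rw [sat_tileAxioms hR] at ht
  have hex : ∀ i, ∃ θ : Θ, i ≤ N → ∀ θ', (tile θ').Sat R V (x i) ↔ θ = θ' := fun i => by
    by_cases hi : i ≤ N
    · obtain ⟨θ, hθ, hu⟩ := ht _ (h.mem hi)
      exact ⟨θ, fun _ θ' => ⟨fun hθ' => (hu θ' hθ').symm, fun e => e ▸ hθ⟩⟩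
    · exact ⟨T.edge, fun hi' => absurd hi' hi⟩
  choose τ hτ using hex
  obtain ⟨s, hsN, rfl⟩ := (h.mem_iff w).1 hw0
  obtain ⟨h1, h2, h3, h4, h5, h6⟩ := (T.sat_start hR h hτ L hsN).1 hw
  obtain ⟨h7, h8, h9⟩ := (T.sat_ruleAxioms hR h hm hτ).1 hr
  exact ⟨N, m, s, τ, h1, h3, h4, h7, h8, h2, h5, h6, h9, (T.sat_reachesGoal hR h hτ).1 hgoal⟩

theorem IsTiling.sat_formula {T : TileSystem Θ} {L : List Θ} {s : ℕ} (ht : T.IsTiling L N m s τ)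
    (hR : R.IsRegionStructure) (h : R.IsGrid V N m x) (h1 : R.IsChain (V 1))
    (h2 : R.IsChain (V 2)) (hτ : ∀ i ≤ N, ∀ θ, (tile θ).Sat R V (x i) ↔ τ i = θ) (w : R.W) :
    (T.formula L).Sat R V w := by
  have hm : 1 ≤ m := by
    have := ht.fits
    omega
  have hs : s ≤ N := le_trans (Nat.le_add_right _ _) ht.fits'
  refine ⟨⟨h.sat_gridAxioms hR h1 h2 w, ?_, ?_, ?_⟩, ?_⟩
  · rw [sat_tileAxioms hR]
    intro a ha
    obtain ⟨i, hi, rfl⟩ := (h.mem_iff a).1 ha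
    exact ⟨τ i, (hτ i hi _).2 rfl, fun θ hθ => ((hτ i hi θ).1 hθ).symm⟩
  · exact (T.sat_ruleAxioms hR h hm hτ).2 ⟨ht.edge_zero, ht.edge_up, ht.step⟩
  · exact (T.sat_reachesGoal hR h hτ).2 ht.goal
  · exact (sat_exi hR).2 ⟨x s, (T.sat_start hR h hτ L hs).2 ⟨ht.start_pos, ht.before, ht.fits,
      ht.fits', ht.input, ht.after⟩⟩

end

end TileSystem

/-! ### Grids of intervals -/

/-- The relation between the intervals `[-(a + 1), b + 1]` and `[-(a' + 1), b' + 1]` for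
`u = (a, b)` and `v = (a', b')`. -/
def gridRel (u v : ℕ × ℕ) : RCC8 :=
  if u.1 = v.1 ∧ u.2 = v.2 then .eq
  else if u.1 < v.1 ∧ u.2 < v.2 then .ntpp
  else if v.1 < u.1 ∧ v.2 < u.2 then .ntppi
  else if u.1 ≤ v.1 ∧ u.2 ≤ v.2 then .tpp
  else if v.1 ≤ u.1 ∧ v.2 ≤ u.2 then .tppi
  else .po

theorem gridRel_eq_tpp {u v : ℕ × ℕ} :
    gridRel u v = .tpp ↔ (u.1 = v.1 ∧ u.2 < v.2) ∨ (u.1 < v.1 ∧ u.2 = v.2) := by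
  unfold gridRel
  split_ifs <;> simp only [false_iff, true_iff] <;> omega

theorem gridRel_eq_ntpp {u v : ℕ × ℕ} : gridRel u v = .ntpp ↔ u.1 < v.1 ∧ u.2 < v.2 := by
  unfold gridRel
  split_ifs <;> simp only [false_iff, true_iff] <;> omega

theorem gridRel_eq_eq {u v : ℕ × ℕ} : gridRel u v = .eq ↔ u = v := by
  unfold gridRel
  split_ifs <;> simp only [false_iff, true_iff, Prod.ext_iff] <;> omega

namespace RCC8Structure

/-- The regions `g u` are related like intervals around the origin of the real line. -/
def IsIntervalGrid (R : RCC8Structure.{u}) (g : ℕ × ℕ → R.W) : Prop :=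
  ∀ u v, R.rel (gridRel u v) (g u) (g v)

theorem IsIntervalGrid.iso {R : RCC8Structure.{u}} {R' : RCC8Structure} (e : R.Iso R')
    {g : ℕ × ℕ → R'.W} (hg : R'.IsIntervalGrid g) :
    R.IsIntervalGrid fun u => e.toEquiv.symm (g u) := fun u v => by
  rw [← e.rel_iff]
  simpa using hg u v

theorem IsIntervalGrid.rel_iff {R : RCC8Structure.{u}} {g : ℕ × ℕ → R.W}
    (hg : R.IsIntervalGrid g) (hR : R.IsRegionStructure) (r : RCC8) (u v : ℕ × ℕ) :
    R.rel r (g u) (g v) ↔ gridRel u v = r :=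
  ⟨fun h => hR.disjoint _ _ _ _ (hg u v) h, fun h => h ▸ hg u v⟩

theorem IsIntervalGrid.injective {R : RCC8Structure.{u}} {g : ℕ × ℕ → R.W}
    (hg : R.IsIntervalGrid g) (hR : R.IsRegionStructure) : Function.Injective g := fun u v h =>
  gridRel_eq_eq.1 (hR.disjoint _ _ _ _ (hg u v) ((hR.eq_iff _ _).2 h))

/-- Cells are the symmetric intervals `(i, i)`, the connector from `(i, i)` to `(i + 1, i + 1)` is
`(i, i + 1)`, and the connector from `(i, i)` to `(i + m, i + m)` is `(i + m, i)`. -/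
theorem IsIntervalGrid.exists_sat {R : RCC8Structure.{u}} {g : ℕ × ℕ → R.W}
    (hg : R.IsIntervalGrid g) (hR : R.IsRegionStructure) {Θ : Type*} [Fintype Θ]
    {T : TileSystem Θ} {L : List Θ} {N m s : ℕ} {τ : ℕ → Θ} (ht : T.IsTiling L N m s τ) :
    ∃ A : Set R.W, A.Finite ∧ A.Nonempty ∧
      ∃ V s, (T.formula L).Sat (R.restrict A) V s := by
  let A : Set R.W := g '' (Set.Iic (N + 1) ×ˢ Set.Iic (N + 1))
  have hA : ∀ a b, a ≤ N + 1 → b ≤ N + 1 → g (a, b) ∈ A := fun a b ha hb =>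
    ⟨(a, b), ⟨ha, hb⟩, rfl⟩
  have hAne : A.Nonempty := ⟨_, hA 0 0 (Nat.zero_le _) (Nat.zero_le _)⟩
  refine ⟨A, ((Set.finite_Iic _).prod (Set.finite_Iic _)).image g, hAne, ?_⟩
  have hm : 1 ≤ m := by
    have := ht.fits
    omega
  -- points of `A` that are neither cells nor connectors satisfy no variable and do no harm
  let V : ℕ → Set (R.restrict A).W := fun k => {w |
    (k = 0 ∧ ∃ i ≤ N, w.1 = g (i, i)) ∨ (k = 1 ∧ ∃ i, i + 1 ≤ N ∧ w.1 = g (i, i + 1)) ∨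
    (k = 2 ∧ ∃ i, i + m ≤ N ∧ w.1 = g (i + m, i)) ∨
    ∃ i ≤ N, k = 3 + Fintype.equivFin Θ (τ i) ∧ w.1 = g (i, i)}
  have hV : ∀ k w, w ∈ V k ↔ (k = 0 ∧ ∃ i ≤ N, w.1 = g (i, i)) ∨
      (k = 1 ∧ ∃ i, i + 1 ≤ N ∧ w.1 = g (i, i + 1)) ∨
      (k = 2 ∧ ∃ i, i + m ≤ N ∧ w.1 = g (i + m, i)) ∨
      ∃ i ≤ N, k = 3 + Fintype.equivFin Θ (τ i) ∧ w.1 = g (i, i) := fun _ _ => Iff.rfl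
  have hV0 : ∀ w, w ∈ V 0 ↔ ∃ i ≤ N, w.1 = g (i, i) := fun w => by
    rw [hV]
    constructor
    · rintro (⟨-, h⟩ | ⟨h, -⟩ | ⟨h, -⟩ | ⟨i, -, h, -⟩)
      · exact h
      all_goals omega
    · exact fun h => Or.inl ⟨rfl, h⟩
  have hV1 : ∀ w, w ∈ V 1 ↔ ∃ i, i + 1 ≤ N ∧ w.1 = g (i, i + 1) := fun w => by
    rw [hV]
    constructor
    · rintro (⟨h, -⟩ | ⟨-, h⟩ | ⟨h, -⟩ | ⟨i, -, h, -⟩)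
      on_goal 2 => exact h
      all_goals omega
    · exact fun h => Or.inr (Or.inl ⟨rfl, h⟩)
  have hV2 : ∀ w, w ∈ V 2 ↔ ∃ i, i + m ≤ N ∧ w.1 = g (i + m, i) := fun w => by
    rw [hV]
    constructor
    · rintro (⟨h, -⟩ | ⟨h, -⟩ | ⟨-, h⟩ | ⟨i, -, h, -⟩)
      on_goal 3 => exact h
      all_goals omega
    · exact fun h => Or.inr (Or.inr (Or.inl ⟨rfl, h⟩))
  have hVt : ∀ θ w, w ∈ V (3 + Fintype.equivFin Θ θ) ↔ ∃ i ≤ N, τ i = θ ∧ w.1 = g (i, i) :=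
    fun θ w => by
    rw [hV]
    constructor
    · rintro (⟨h, -⟩ | ⟨h, -⟩ | ⟨h, -⟩ | ⟨i, hi, h, hw⟩)
      on_goal 4 =>
        exact ⟨i, hi, ((Fintype.equivFin Θ).injective (Fin.ext (Nat.add_left_cancel h))).symm, hw⟩
      all_goals omega
    · rintro ⟨i, hi, rfl, hw⟩
      exact Or.inr (Or.inr (Or.inr ⟨i, hi, rfl, hw⟩))
  have hrel := hg.rel_iff hR
  have hinj := hg.injective hR
  have hR' := hR.restrict hAne
  let x : ℕ → (R.restrict A).W := fun i => ⟨g (min i N, min i N), hA _ _ (by omega) (by omega)⟩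
  have hx : ∀ i ≤ N, (x i).1 = g (i, i) := fun i hi => by simp [x, min_eq_left hi]
  have hchain : ∀ (p : ℕ → ℕ × ℕ) (Q : ℕ → Prop) (E : Set (R.restrict A).W),
      (∀ w, w ∈ E ↔ ∃ i, Q i ∧ w.1 = g (p i)) →
      (∀ i j, i < j → gridRel (p i) (p j) = .ntpp) → (R.restrict A).IsChain E := by
    intro p Q E hE hp a ha b hb
    obtain ⟨i, -, ha⟩ := (hE a).1 ha
    obtain ⟨j, -, hb⟩ := (hE b).1 hb
    simp only [restrict, ha, hb, hrel]
    rcases lt_trichotomy i j with hij | rfl | hij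
    · exact Or.inl (hp _ _ hij)
    · exact Or.inr (Or.inl (Subtype.ext (ha.trans hb.symm)))
    · exact Or.inr (Or.inr (hp _ _ hij))
  have hlink : ∀ (p : ℕ → ℕ × ℕ) (Q : ℕ → Prop) (E : Set (R.restrict A).W),
      (∀ w, w ∈ E ↔ ∃ i, Q i ∧ w.1 = g (p i)) →
      (∀ i, Q i → (p i).1 ≤ N + 1 ∧ (p i).2 ≤ N + 1) →
      ∀ i j, i ≤ N → j ≤ N → ((R.restrict A).Linked E (x i) (x j) ↔
        ∃ k, Q k ∧ gridRel (i, i) (p k) = .tpp ∧ gridRel (p k) (j, j) = .tpp) := by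
    intro p Q E hE hp i j hi hj
    constructor
    · rintro ⟨l, hl, h1, h2⟩
      obtain ⟨k, hk, hl⟩ := (hE l).1 hl
      simp only [restrict, hl, hx i hi, hx j hj, hrel] at h1 h2
      exact ⟨k, hk, h1, h2⟩
    · rintro ⟨k, hk, h1, h2⟩
      refine ⟨⟨g (p k), hA _ _ (hp k hk).1 (hp k hk).2⟩, (hE _).2 ⟨k, hk, rfl⟩, ?_, ?_⟩
      · simpa only [restrict, hx i hi, hrel] using h1
      · simpa only [restrict, hx j hj, hrel] using h2
  refine ⟨V, x 0, ht.sat_formula (x := x) hR' ⟨fun w => ?_, fun i j hi hj => ?_,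
    fun i j hi hj => ?_, fun i j hi hj => ?_⟩ ?_ ?_ ?_ _⟩
  · rw [hV0]
    exact exists_congr fun i => and_congr_right fun hi =>
      ⟨fun h => Subtype.ext ((hx i hi).trans h.symm), fun h => h ▸ hx i hi⟩
  · simp only [restrict, hx i hi, hx j hj, hrel, gridRel_eq_ntpp, and_self]
  · rw [hlink (fun i => (i, i + 1)) (fun i => i + 1 ≤ N) _ hV1 (fun i hi => by
      simp only
      omega) i j hi hj]
    simp only [gridRel_eq_tpp]
    constructor
    · rintro ⟨k, -, h1, h2⟩
      omega
    · rintro rfl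
      exact ⟨i, by omega⟩
  · rw [hlink (fun i => (i + m, i)) (fun i => i + m ≤ N) _ hV2 (fun i hi => by
      simp only
      omega) i j hi hj]
    simp only [gridRel_eq_tpp]
    constructor
    · rintro ⟨k, -, h1, h2⟩
      omega
    · rintro rfl
      exact ⟨i, by omega⟩
  · exact hchain (fun i => (i, i + 1)) _ _ hV1 fun i j hij => gridRel_eq_ntpp.2 (by
      simp only
      omega)
  · exact hchain (fun i => (i + m, i)) _ _ hV2 fun i j hij => gridRel_eq_ntpp.2 (by
      simp only
      omega)
  · intro i hi θ
    rw [TileSystem.tile, RCC8Formula.sat_var, hVt, hx i hi]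
    constructor
    · rintro ⟨j, -, hj, h⟩
      have := hinj h
      simp only [Prod.mk.injEq, and_self] at this
      rw [this, hj]
    · exact fun h => ⟨i, hi, h, rfl⟩

end RCC8Structure

section Intervals

variable {X : Type u} [TopologicalSpace X] {π : X → ℝ}

/-- The preimage of the interval `[-(a + 1), b + 1]` under a real-valued function. -/
def stripe (π : X → ℝ) (u : ℕ × ℕ) : Set X := π ⁻¹' Set.Icc (-(u.1 + 1 : ℝ)) (u.2 + 1)

theorem stripe_bounds (u : ℕ × ℕ) : -(u.1 + 1 : ℝ) < 0 ∧ (0 : ℝ) < u.2 + 1 := by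
  constructor
  · have : (0 : ℝ) ≤ u.1 := Nat.cast_nonneg _
    linarith
  · positivity

theorem interior_stripe (hc : Continuous π) (ho : IsOpenMap π) (u : ℕ × ℕ) :
    interior (stripe π u) = π ⁻¹' Set.Ioo (-(u.1 + 1 : ℝ)) (u.2 + 1) := by
  rw [stripe, ← ho.preimage_interior_eq_interior_preimage hc, interior_Icc]

theorem stripe_mem_regRegions (hc : Continuous π) (ho : IsOpenMap π) (hs : π.Surjective)
    (u : ℕ × ℕ) : stripe π u ∈ regRegions X := by
  obtain ⟨h1, h2⟩ := stripe_bounds u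
  constructor
  · obtain ⟨y, hy⟩ := hs 0
    exact ⟨y, by rw [stripe, Set.mem_preimage, hy]; exact ⟨h1.le, h2.le⟩⟩
  · rw [interior_stripe hc ho, ← ho.preimage_closure_eq_closure_preimage hc,
      closure_Ioo (h1.trans h2).ne, stripe]

theorem holds_gridRel_stripe (hc : Continuous π) (ho : IsOpenMap π) (hs : π.Surjective)
    (u v : ℕ × ℕ) : (gridRel u v).Holds (stripe π u) (stripe π v) := by
  have hP : ∀ u v, stripe π u ⊆ stripe π v ↔ u.1 ≤ v.1 ∧ u.2 ≤ v.2 := fun u v => by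
    obtain ⟨h1, h2⟩ := stripe_bounds u
    rw [stripe, stripe, hs.preimage_subset_preimage_iff, Set.Icc_subset_Icc_iff (h1.trans h2).le,
      neg_le_neg_iff, add_le_add_iff_right, add_le_add_iff_right, Nat.cast_le, Nat.cast_le]
  have hN : ∀ u v, stripe π u ⊆ interior (stripe π v) ↔ u.1 < v.1 ∧ u.2 < v.2 := fun u v => by
    obtain ⟨h1, h2⟩ := stripe_bounds u
    rw [interior_stripe hc ho, stripe, hs.preimage_subset_preimage_iff,
      Set.Icc_subset_Ioo_iff (h1.trans h2).le, neg_lt_neg_iff, add_lt_add_iff_right,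
      add_lt_add_iff_right, Nat.cast_lt, Nat.cast_lt]
  have hE : ∀ u v, stripe π u = stripe π v ↔ u.1 = v.1 ∧ u.2 = v.2 := fun u v => by
    rw [Set.Subset.antisymm_iff, hP, hP]
    omega
  have hO : interior (stripe π u) ∩ interior (stripe π v) ≠ ∅ := by
    obtain ⟨y, hy⟩ := hs 0
    rw [interior_stripe hc ho, interior_stripe hc ho, ← Set.nonempty_iff_ne_empty]
    refine ⟨y, ?_, ?_⟩ <;> rw [Set.mem_preimage, hy] <;> exact stripe_bounds _
  unfold gridRel
  split_ifs <;> simp only [RCC8.Holds, hP, hN, hE, Ne, hO, not_false_eq_true, true_and] <;> omega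

theorem isIntervalGrid_concrete {U : Set (Set X)} (hc : Continuous π) (ho : IsOpenMap π)
    (hs : π.Surjective) (hU : ∀ u, stripe π u ∈ U) :
    (RCC8Structure.concrete X U).IsIntervalGrid fun u => ⟨stripe π u, hU u⟩ :=
  fun u v => holds_gridRel_stripe hc ho hs u v

end Intervals

theorem exists_isIntervalGrid_regStructure {n : ℕ} (hn : 1 ≤ n) :
    ∃ g, (regStructure n).IsIntervalGrid g := by
  let k : Fin n := ⟨0, hn⟩
  have hc : Continuous fun y : Fin n → ℝ => y k := continuous_apply k
  have ho : IsOpenMap fun y : Fin n → ℝ => y k := isOpenMap_eval k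
  have hs : Function.Surjective fun y : Fin n → ℝ => y k := Function.surjective_eval k
  exact ⟨_, isIntervalGrid_concrete hc ho hs (stripe_mem_regRegions hc ho hs)⟩

theorem exists_isIntervalGrid_rectStructure {n : ℕ} (hn : 1 ≤ n) :
    ∃ g, (rectStructure n).IsIntervalGrid g := by
  let k : Fin n := ⟨0, hn⟩
  have hc : Continuous fun y : Fin n → ℝ => y k := continuous_apply k
  have ho : IsOpenMap fun y : Fin n → ℝ => y k := isOpenMap_eval k
  have hs : Function.Surjective fun y : Fin n → ℝ => y k := Function.surjective_eval k
  refine ⟨_, isIntervalGrid_concrete hc ho hs fun u => ?_⟩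
  obtain ⟨h1, h2⟩ := stripe_bounds u
  -- the other sides of the rectangle are unbounded
  refine ⟨Function.update (fun _ => Set.univ) k (Set.Icc (-(u.1 + 1 : ℝ)) (u.2 + 1)),
    fun i => ?_, ?_⟩
  · rcases eq_or_ne i k with rfl | hi
    · rw [Function.update_self]
      exact ⟨isClosed_Icc, Set.ordConnected_Icc, _, Set.left_mem_Icc.2 (h1.trans h2).le, _,
        Set.right_mem_Icc.2 (h1.trans h2).le, (h1.trans h2).ne⟩
    · rw [Function.update_of_ne hi]
      exact ⟨isClosed_univ, Set.ordConnected_univ, Set.nontrivial_univ⟩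
  · ext y
    simp only [stripe, Set.mem_preimage, Set.mem_univ_pi]
    constructor
    · intro h i
      rcases eq_or_ne i k with rfl | hi
      · rwa [Function.update_self]
      · rw [Function.update_of_ne hi]
        trivial
    · intro h
      have := h k
      rwa [Function.update_self] at this

theorem exists_classTOP_isIntervalGrid :
    ∃ R ∈ classTOP.{u}, ∃ g, R.IsIntervalGrid g := by
  have hc : Continuous (ULift.down : ULift.{u} ℝ → ℝ) := continuous_uliftDown
  have ho : IsOpenMap (ULift.down : ULift.{u} ℝ → ℝ) := Homeomorph.ulift.isOpenMap
  have hs : Function.Surjective (ULift.down : ULift.{u} ℝ → ℝ) := ULift.down_surjective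
  exact ⟨_, ⟨ULift.{u} ℝ, inferInstance, inferInstance, rfl⟩, _,
    isIntervalGrid_concrete hc ho hs (stripe_mem_regRegions hc ho hs)⟩

/-! ### Space-time diagrams of Turing machines -/

namespace Turing.TM0

section Diagram

variable {Γ Λ : Type*}

/-- A tile separates two rows (`none`), or carries a tape symbol and, if the head is there, the state
of the machine. -/
abbrev HeadTile (Γ Λ : Type*) := Option (Γ × Option Λ)

/-- The state on a tile. -/
def HeadTile.state : HeadTile Γ Λ → Option Λ
  | some (_, q) => q
  | none => none

/-- The tile at `z` for a configuration whose head is at `p`. -/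
def Cfg.tileAt [Inhabited Γ] (c : Cfg Γ Λ) (p z : ℤ) : HeadTile Γ Λ :=
  some (c.Tape.nth (z - p), if z = p then some c.q else none)

theorem Cfg.state_tileAt_of_ne [Inhabited Γ] (c : Cfg Γ Λ) {p z : ℤ} (h : z ≠ p) :
    (c.tileAt p z).state = none := by
  simp [tileAt, HeadTile.state, h]

variable [Inhabited Λ] (M : Machine Γ Λ)

/-- The state in which the head leaves a tile in direction `d`, if it does. -/
def leaves (d : Dir) : HeadTile Γ Λ → Option Λ
  | some (a, some q) =>
    match M q a with
    | some (q', .move d') => if d' = d then some q' else none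
    | _ => none
  | _ => none

/-- The tile above a given one. -/
def nextTile (l c r : HeadTile Γ Λ) : HeadTile Γ Λ :=
  match c with
  | none => none
  | some (a, some q) =>
    match M q a with
    | some (q', .write b) => some (b, some q')
    | _ => some (a, none)
  | some (a, none) => some (a, (leaves M .right l).or (leaves M .left r))

theorem leaves_of_state_eq_none {d : Dir} {θ : HeadTile Γ Λ} (h : θ.state = none) :
    leaves M d θ = none := by
  rcases θ with - | ⟨a, - | q⟩
  · rfl
  · rfl
  · cases h

theorem nextTile_congr {l l' c r r' : HeadTile Γ Λ} (hl : leaves M .right l = leaves M .right l')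
    (hr : leaves M .left r = leaves M .left r') : nextTile M l c r = nextTile M l' c r' := by
  rcases c with - | ⟨a, - | q⟩ <;> simp [nextTile, hl, hr]

theorem state_nextTile_eq_none {l c r : HeadTile Γ Λ} (hl : leaves M .right l = none)
    (hc : c.state = none) (hr : leaves M .left r = none) : (nextTile M l c r).state = none := by
  rcases c with - | ⟨a, - | q⟩
  · rfl
  · simp [nextTile, HeadTile.state, hl, hr]
  · cases hc

variable [Inhabited Γ]

/-- The tiling system of the space-time diagrams of a Turing machine. A head that runs into an edge
tile disappears, so that a goal tile only occurs if the rows are long enough. -/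
def tileSystem : TileSystem (HeadTile Γ Λ) where
  edge := none
  blank := some (default, none)
  next := nextTile M
  goal := {θ | ∃ a q, θ = some (a, some q) ∧ M q a = none}

/-- The tiles of the input. -/
def inputTiles (l : List Γ) : List (HeadTile Γ Λ) :=
  some (l.headI, some default) :: l.tail.map fun a => some (a, none)

/-- The displacement of the head in the next step. -/
def shift (c : Cfg Γ Λ) : ℤ :=
  match M c.q c.Tape.head with
  | some (_, .move .left) => -1
  | some (_, .move .right) => 1
  | _ => 0

theorem leaves_tileAt_of_ne (d : Dir) (c : Cfg Γ Λ) {p z : ℤ} (h : z ≠ p) :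
    leaves M d (c.tileAt p z) = none :=
  leaves_of_state_eq_none M (c.state_tileAt_of_ne h)

theorem leaves_tileAt_self (d : Dir) (c : Cfg Γ Λ) (p : ℤ) :
    leaves M d (c.tileAt p p) = match M c.q c.Tape.head with
      | some (q', .move d') => if d' = d then some q' else none
      | _ => none := by
  simp only [Cfg.tileAt, sub_self, Tape.nth_zero, if_true, leaves]

theorem shift_mem (c : Cfg Γ Λ) : -1 ≤ shift M c ∧ shift M c ≤ 1 := by
  unfold shift
  split <;> simp

/-- One step of the machine, seen tile by tile, is given by `nextTile`. -/
theorem tileAt_step {c c' : Cfg Γ Λ} (h : c' ∈ step M c) (p z : ℤ) :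
    c'.tileAt (p + shift M c) z =
      nextTile M (c.tileAt p (z - 1)) (c.tileAt p z) (c.tileAt p (z + 1)) := by
  obtain ⟨q, T⟩ := c
  obtain ⟨⟨q', s⟩, hM, rfl⟩ := Option.map_eq_some_iff.1 h
  rcases eq_or_ne z p with rfl | hz
  · rcases s with (- | -) | b <;>
      simp [Cfg.tileAt, nextTile, shift, hM, Tape.move_left_nth, Tape.move_right_nth,
        Tape.nth_zero]
    rfl
  · have hz' : z - p ≠ 0 := sub_ne_zero.2 hz
    have hc : ∀ l r : HeadTile Γ Λ, nextTile M l (Cfg.tileAt ⟨q, T⟩ p z) r =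
        some (T.nth (z - p), (leaves M .right l).or (leaves M .left r)) := fun l r => by
      simp [Cfg.tileAt, nextTile, hz]
    rw [hc]
    rcases eq_or_ne (z - 1) p with hl | hl
    · have hr : z + 1 ≠ p := by omega
      rw [leaves_tileAt_of_ne M _ _ hr, hl, leaves_tileAt_self]
      rcases s with (- | -) | b <;>
        simp [Cfg.tileAt, shift, hM, Tape.move_left_nth, Tape.move_right_nth, Tape.write_nth, hz,
          hz'] <;> grind
    · rw [leaves_tileAt_of_ne M _ _ hl]
      rcases eq_or_ne (z + 1) p with hr | hr
      · rw [hr, leaves_tileAt_self]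
        rcases s with (- | -) | b <;>
          simp [Cfg.tileAt, shift, hM, Tape.move_left_nth, Tape.move_right_nth, Tape.write_nth, hz,
            hz'] <;> grind
      · rw [leaves_tileAt_of_ne M _ _ hr]
        rcases s with (- | -) | b <;>
          simp [Cfg.tileAt, shift, hM, Tape.move_left_nth, Tape.move_right_nth, Tape.write_nth, hz,
            hz'] <;> grind

theorem leaves_tileAt_of_halted {c : Cfg Γ Λ} (h : step M c = none) (d : Dir) (p z : ℤ) :
    leaves M d (c.tileAt p z) = none := by
  rcases eq_or_ne z p with rfl | hz
  · rw [leaves_tileAt_self]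
    obtain ⟨q, T⟩ := c
    rw [Option.map_eq_none_iff.1 h]
  · exact leaves_tileAt_of_ne M d c hz

theorem state_nextTile_of_halted {c : Cfg Γ Λ} (h : step M c = none) {l r : HeadTile Γ Λ}
    (hl : leaves M .right l = none) (hr : leaves M .left r = none) (p z : ℤ) :
    (nextTile M l (c.tileAt p z) r).state = none := by
  rcases eq_or_ne z p with rfl | hz
  · obtain ⟨q, T⟩ := c
    have hM : M q T.head = none := Option.map_eq_none_iff.1 h
    simp [Cfg.tileAt, nextTile, hM, Tape.nth_zero, HeadTile.state]
  · exact state_nextTile_eq_none M hl (c.state_tileAt_of_ne hz) hr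

theorem nth_mk₁_nat (l : List Γ) (n : ℕ) : (Tape.mk₁ l).nth n = l.getI n := by
  rw [Tape.mk₁, Tape.mk₂, Tape.mk'_nth_nat, ListBlank.nth_mk]

theorem nth_mk₁_neg (l : List Γ) {z : ℤ} (hz : z < 0) : (Tape.mk₁ l).nth z = default := by
  obtain ⟨n, rfl⟩ := Int.eq_negSucc_of_lt_zero hz
  change (ListBlank.mk ([] : List Γ)).nth n = default
  rw [ListBlank.nth_mk]
  simp

theorem getElem?_inputTiles (l : List Γ) (j : ℕ) (θ : HeadTile Γ Λ)
    (h : (inputTiles l)[j]? = some θ) : θ = (init (Λ := Λ) l).tileAt 0 j := by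
  rw [Cfg.tileAt, sub_zero]
  change θ = some ((Tape.mk₁ l).nth j, _)
  rw [nth_mk₁_nat]
  rcases j with - | j
  · simp only [inputTiles, List.getElem?_cons_zero, Option.some.injEq] at h
    subst h
    cases l <;> simp [init]
  · simp only [inputTiles, List.getElem?_cons_succ, List.getElem?_map,
      Option.map_eq_some_iff] at h
    obtain ⟨a, ha, rfl⟩ := h
    have : ((j + 1 : ℕ) : ℤ) ≠ 0 := by omega
    rw [if_neg this]
    rcases l with - | ⟨b, l⟩
    · simp at ha
    · simp only [List.tail_cons] at ha
      rw [List.getI_cons_succ, List.getI_eq_getElem?_getD, ha, Option.getD_some]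

theorem tileAt_init_of_lt (l : List Γ) {z : ℤ} (hz : z < 0) :
    (init (Λ := Λ) l).tileAt 0 z = some (default, none) := by
  rw [Cfg.tileAt, sub_zero, if_neg hz.ne]
  change some ((Tape.mk₁ l).nth z, _) = _
  rw [nth_mk₁_neg l hz]

theorem tileAt_init_of_ge (l : List Γ) {j : ℕ} (hj : (inputTiles (Λ := Λ) l).length ≤ j) :
    (init (Λ := Λ) l).tileAt 0 j = some (default, none) := by
  simp only [inputTiles, List.length_cons, List.length_map, List.length_tail] at hj
  rw [Cfg.tileAt, sub_zero, if_neg (by omega)]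
  change some ((Tape.mk₁ l).nth j, _) = _
  rw [nth_mk₁_nat, List.getI_eq_default _ (by omega)]

/-- A halting run of length `T` gives a tiling: with the input at column `T + 2` the head stays away
from the edges. -/
theorem exists_isTiling_of_halts {l : List Γ} (h : (eval M l).Dom) :
    ∃ N m s τ, (tileSystem M).IsTiling (inputTiles l) N m s τ := by
  obtain ⟨b, hb⟩ := Part.dom_iff_mem.1 (show (StateTransition.eval (step M) (init l)).Dom from h)
  obtain ⟨hreach, hhalt⟩ := StateTransition.mem_eval.1 hb
  obtain ⟨T, c, hc0, hcT, hc⟩ : ∃ (T : ℕ) (c : ℕ → Cfg Γ Λ), c 0 = init l ∧ c T = b ∧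
      ∀ t < T, c (t + 1) ∈ step M (c t) := by
    clear hhalt hb
    induction hreach with
    | refl => exact ⟨0, fun _ => init l, rfl, rfl, by simp⟩
    | @tail b b' _ hbb' ih =>
      obtain ⟨T, c, h0, hT, hs⟩ := ih
      refine ⟨T + 1, fun t => if t ≤ T then c t else b', by simpa using h0, by simp,
        fun t ht => ?_⟩
      rcases Nat.lt_or_eq_of_le (Nat.lt_succ_iff.1 ht) with ht | rfl
      · simpa [ht.le, Nat.succ_le_of_lt ht] using hs t ht
      · simpa [hT] using hbb'
  -- the position of the head
  let p : ℕ → ℤ := fun t => ∑ k ∈ Finset.range t, shift M (c k)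
  have hp0 : p 0 = 0 := rfl
  have hps : ∀ t, p (t + 1) = p t + shift M (c t) := fun t => Finset.sum_range_succ _ _
  have hpb : ∀ t : ℕ, -(t : ℤ) ≤ p t ∧ p t ≤ t := fun t => by
    induction t with
    | zero => simp [hp0]
    | succ t ih =>
      have := shift_mem M (c t)
      have := hps t
      push_cast
      omega
  set n := (inputTiles (Λ := Λ) l).length with hn
  let m := 2 * T + n + 6
  have hm : m = 2 * T + n + 6 := rfl
  clear_value m
  let τ : ℕ → HeadTile Γ Λ := fun i =>
    if i % m = 0 then none else (c (i / m)).tileAt (p (i / m)) ((i % m : ℕ) - (T + 2 : ℕ))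
  have hτ0 : ∀ t, τ (t * m) = none := fun t => if_pos (Nat.mul_mod_left t m)
  have hτ : ∀ t j, 1 ≤ j → j < m → τ (t * m + j) = (c t).tileAt (p t) (j - (T + 2 : ℕ)) :=
    fun t j h1 h2 => by
      have hmod : (t * m + j) % m = j := by
        rw [Nat.add_comm, Nat.add_mul_mod_self_right, Nat.mod_eq_of_lt h2]
      have hdiv : (t * m + j) / m = t := by
        rw [Nat.add_comm, Nat.add_mul_div_right _ _ (by omega), Nat.div_eq_of_lt h2, zero_add]
      simp only [τ, hmod, hdiv]
      rw [if_neg (by omega)]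
  have hN : m * (T + 1) = T * m + m := by ring
  refine ⟨T * m + m - 1, m, T + 2, τ, ⟨by omega, by omega, ?_, ?_, ?_, ?_, ?_, ?_, ?_, ?_⟩⟩
  · have : 0 ≤ T * m := Nat.zero_le _
    omega
  · exact zero_mul m ▸ hτ0 0
  · exact fun _ => one_mul m ▸ hτ0 1
  · intro j h1 h2
    have := hτ 0 j h1 (by omega)
    rw [zero_mul, zero_add, hc0, hp0] at this
    rw [this, tileAt_init_of_lt l (by omega)]
    rfl
  · intro j θ hj
    have hjn : j < n := (List.getElem?_eq_some_iff.1 hj).1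
    have := hτ 0 (T + 2 + j) (by omega) (by omega)
    rw [zero_mul, zero_add, hc0, hp0] at this
    rw [this, getElem?_inputTiles l j θ hj]
    congr 1
    push_cast
    ring
  · intro j h1 h2 _
    have := hτ 0 j (by omega) h2
    rw [zero_mul, zero_add, hc0, hp0] at this
    obtain ⟨k, rfl⟩ := Nat.exists_eq_add_of_le (show T + 2 ≤ j by omega)
    rw [this, show ((T + 2 + k : ℕ) : ℤ) - (T + 2 : ℕ) = (k : ℕ) by push_cast; ring,
      tileAt_init_of_ge l (by omega)]
    rfl
  · intro i hi hiN
    obtain ⟨t, j, hj, rfl⟩ : ∃ t j, j < m ∧ i = t * m + j :=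
      ⟨i / m, i % m, Nat.mod_lt _ (by omega), by rw [mul_comm, Nat.div_add_mod]⟩
    have ht : t < T := by
      by_contra hcon
      have := Nat.mul_le_mul_right m (not_lt.1 hcon)
      omega
    have e1 : t * m + j + m = (t + 1) * m + j := by ring
    rcases Nat.eq_zero_or_pos j with rfl | hj0
    · rw [e1, add_zero, add_zero, hτ0, hτ0]
      rfl
    · rw [e1, hτ _ _ hj0 hj, hps, tileAt_step M (hc t ht), hτ _ _ hj0 hj]
      have hpt := hpb t
      refine nextTile_congr M ?_ ?_
      · rcases Nat.eq_or_lt_of_le hj0 with hj1 | hj1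
        · rw [← hj1, Nat.add_sub_cancel, hτ0]
          exact leaves_tileAt_of_ne M _ _ (by push_cast; omega)
        · rw [Nat.add_sub_assoc hj0, hτ _ _ (by omega) (by omega)]
          congr 2
          push_cast [hj0]
          ring
      · rcases Nat.eq_or_lt_of_le hj with hj1 | hj1
        · rw [show t * m + j + 1 = (t + 1) * m by rw [add_mul]; omega, hτ0]
          exact leaves_tileAt_of_ne M _ _ (by push_cast; omega)
        · rw [add_assoc, hτ _ _ (by omega) hj1]
          congr 2
          push_cast
          ring
  · have hpT := hpb T
    obtain ⟨j, hj⟩ : ∃ j : ℕ, (j : ℤ) = p T + (T + 2 : ℕ) := ⟨(p T + (T + 2 : ℕ)).toNat, by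
      rw [Int.toNat_of_nonneg]
      push_cast
      omega⟩
    refine ⟨T * m + j, by omega, ?_⟩
    rw [hτ T j (by omega) (by omega), hcT, hj, add_sub_cancel_right, Cfg.tileAt, if_pos rfl,
      sub_self, Tape.nth_zero]
    refine ⟨_, _, rfl, ?_⟩
    obtain ⟨q, T'⟩ := b
    exact Option.map_eq_none_iff.1 hhalt

/-- Every row of a tiling either shows a configuration that the machine reaches, or carries no head. A
goal tile occurs in a row of the first kind. -/
theorem halts_of_isTiling {l : List Γ} {N m s : ℕ} {τ : ℕ → HeadTile Γ Λ}
    (ht : (tileSystem M).IsTiling (inputTiles l) N m s τ) : (eval M l).Dom := by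
  have hm : s + 1 < m := by
    have := ht.fits
    simp only [inputTiles, List.length_cons] at this
    omega
  have hs := ht.start_pos
  have hedge : ∀ t, t * m ≤ N → τ (t * m) = none := by
    intro t
    induction t with
    | zero => exact fun _ => (zero_mul m).symm ▸ ht.edge_zero
    | succ t ih =>
      intro hN
      rw [Nat.succ_mul] at hN ⊢
      rcases Nat.eq_zero_or_pos t with rfl | h0
      · rw [zero_mul, zero_add] at hN ⊢
        exact ht.edge_up hN
      · rw [ht.step _ (Nat.mul_pos h0 (by omega)) hN, ih (by omega)]
        rfl
  have hrow : ∀ t, (∀ j, 1 ≤ j → j < m → t * m + j ≤ N → (τ (t * m + j)).state = none) ∨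
      ∃ c p, StateTransition.Reaches (step M) (init l) c ∧ -(s : ℤ) < p ∧ p < m - s ∧
        ∀ j, 1 ≤ j → j < m → t * m + j ≤ N → τ (t * m + j) = c.tileAt p (j - s) := by
    intro t
    induction t with
    | zero =>
      refine Or.inr ⟨init l, 0, .refl, by omega, by omega, fun j h1 h2 h3 => ?_⟩
      rw [zero_mul, zero_add] at h3 ⊢
      rcases lt_or_ge j s with hjs | hjs
      · rw [ht.before j h1 hjs, tileAt_init_of_lt l (by omega)]
        rfl
      · obtain ⟨k, rfl⟩ := Nat.exists_eq_add_of_le hjs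
        rw [show ((s + k : ℕ) : ℤ) - s = (k : ℕ) by push_cast; ring]
        rcases lt_or_ge k (inputTiles (Λ := Λ) l).length with hk | hk
        · rw [ht.input k _ (List.getElem?_eq_getElem hk)]
          exact getElem?_inputTiles l k _ (List.getElem?_eq_getElem hk)
        · rw [ht.after _ (by omega) h2 h3, tileAt_init_of_ge l hk]
          rfl
    | succ t ih =>
      have hstep : ∀ j, 1 ≤ j → (t + 1) * m + j ≤ N → τ ((t + 1) * m + j) =
          nextTile M (τ (t * m + j - 1)) (τ (t * m + j)) (τ (t * m + j + 1)) := by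
        intro j h1 h3
        have e : (t + 1) * m + j = t * m + j + m := by ring
        rw [e] at h3 ⊢
        exact ht.step _ (by omega) h3
      -- the neighbours of a cell are edges or belong to the same row
      have hleft : ∀ j, 1 ≤ j → (t + 1) * m + j ≤ N →
          τ (t * m + j - 1) = none ∨ 1 ≤ j - 1 ∧ t * m + j - 1 = t * m + (j - 1) := by
        intro j h1 h3
        rcases Nat.eq_or_lt_of_le h1 with rfl | h1
        · rw [add_mul] at h3
          exact Or.inl (by rw [Nat.add_sub_cancel, hedge t (by omega)])
        · exact Or.inr ⟨by omega, by omega⟩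
      have hright : ∀ j, j < m → (t + 1) * m + j ≤ N →
          τ (t * m + j + 1) = none ∧ j + 1 = m ∨ j + 1 < m := by
        intro j h2 h3
        rcases Nat.eq_or_lt_of_le h2 with h2 | h2
        · refine Or.inl ⟨?_, h2⟩
          rw [show t * m + j + 1 = (t + 1) * m by rw [add_mul]; omega]
          exact hedge _ (by omega)
        · exact Or.inr h2
      have hle : ∀ j, (t + 1) * m + j ≤ N → t * m + j + m ≤ N := fun j h => by
        rw [add_mul] at h
        omega
      rcases ih with ih | ⟨c, p, hc, hp1, hp2, ih⟩
      · refine Or.inl fun j h1 h2 h3 => ?_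
        have h3' := hle j h3
        rw [hstep j h1 h3]
        refine state_nextTile_eq_none M (leaves_of_state_eq_none M ?_) (ih j h1 h2 (by omega))
          (leaves_of_state_eq_none M ?_)
        · rcases hleft j h1 h3 with h | ⟨h, h'⟩
          · rw [h]
            rfl
          · rw [h']
            exact ih _ h (by omega) (by omega)
        · rcases hright j h2 h3 with ⟨h, -⟩ | h
          · rw [h]
            rfl
          · exact ih (j + 1) (by omega) h (by omega)
      · have hl : ∀ j, 1 ≤ j → j < m → (t + 1) * m + j ≤ N →
            leaves M .right (τ (t * m + j - 1)) = leaves M .right (c.tileAt p (j - s - 1)) := by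
          intro j h1 h2 h3
          have h3' := hle j h3
          rcases Nat.eq_or_lt_of_le h1 with rfl | h1'
          · rw [Nat.add_sub_cancel, hedge t (by omega)]
            exact (leaves_tileAt_of_ne M _ _ (by push_cast; omega)).symm
          · rw [Nat.add_sub_assoc h1, ih (j - 1) (by omega) (by omega) (by omega)]
            congr 2
            push_cast [h1]
            ring
        have hr : ∀ j, 1 ≤ j → j < m → (t + 1) * m + j ≤ N →
            leaves M .left (τ (t * m + j + 1)) = leaves M .left (c.tileAt p (j - s + 1)) := by
          intro j h1 h2 h3
          have h3' := hle j h3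
          rcases hright j h2 h3 with ⟨h, hj⟩ | h
          · rw [h]
            exact (leaves_tileAt_of_ne M _ _ (by omega)).symm
          · rw [add_assoc, ih (j + 1) (by omega) h (by omega)]
            congr 2
            push_cast
            ring
        cases hstepc : step M c with
        | none =>
          refine Or.inl fun j h1 h2 h3 => ?_
          have h3' := hle j h3
          rw [hstep j h1 h3, ih j h1 h2 (by omega)]
          exact state_nextTile_of_halted M hstepc
            ((hl j h1 h2 h3).trans (leaves_tileAt_of_halted M hstepc _ _ _))
            ((hr j h1 h2 h3).trans (leaves_tileAt_of_halted M hstepc _ _ _)) _ _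
        | some c' =>
          have hnext : ∀ j, 1 ≤ j → j < m → (t + 1) * m + j ≤ N →
              τ ((t + 1) * m + j) = c'.tileAt (p + shift M c) (j - s) := by
            intro j h1 h2 h3
            have h3' := hle j h3
            rw [hstep j h1 h3, tileAt_step M hstepc, ih j h1 h2 (by omega)]
            exact nextTile_congr M (hl j h1 h2 h3) (hr j h1 h2 h3)
          by_cases hrange : -(s : ℤ) < p + shift M c ∧ p + shift M c < m - s
          · exact Or.inr ⟨c', _, hc.tail hstepc, hrange.1, hrange.2, hnext⟩
          · refine Or.inl fun j h1 h2 h3 => ?_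
            rw [hnext j h1 h2 h3]
            exact c'.state_tileAt_of_ne (by omega)
  obtain ⟨i, hi, a, q, hτ, hM⟩ := ht.goal
  obtain ⟨t, j, hj, rfl⟩ : ∃ t j, j < m ∧ i = t * m + j :=
    ⟨i / m, i % m, Nat.mod_lt _ (by omega), by rw [mul_comm, Nat.div_add_mod]⟩
  rcases Nat.eq_zero_or_pos j with rfl | hj0
  · rw [add_zero] at hi hτ
    rw [hedge t hi] at hτ
    cases hτ
  · rcases hrow t with h | ⟨c, p, hc, -, -, h⟩
    · have := h j hj0 hj hi
      rw [hτ] at this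
      cases this
    · rw [h j hj0 hj hi, Cfg.tileAt, Option.some.injEq, Prod.mk.injEq] at hτ
      obtain ⟨h1, h2⟩ := hτ
      have hz : (j : ℤ) - s = p := by
        by_contra hne
        rw [if_neg hne] at h2
        cases h2
      rw [if_pos hz, Option.some.injEq] at h2
      rw [hz, sub_self, Tape.nth_zero] at h1
      refine Part.dom_iff_mem.2 ⟨_, Part.mem_map _ (StateTransition.mem_eval.2 ⟨hc, ?_⟩)⟩
      obtain ⟨q', T⟩ := c
      refine Option.map_eq_none_iff.2 ?_
      rw [← h1, ← h2] at hM
      exact hM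

end Diagram

end Turing.TM0

/-! ### A universal Turing machine with finitely many states -/

namespace Turing

theorem PartrecToTM2.trNat_eq_map_bits (n : ℕ) :
    PartrecToTM2.trNat n = n.bits.map fun b => cond b PartrecToTM2.Γ'.bit1 PartrecToTM2.Γ'.bit0 := by
  have hpos : ∀ p : PosNum, PartrecToTM2.trPosNum p =
      (p : ℕ).bits.map fun b => cond b PartrecToTM2.Γ'.bit1 PartrecToTM2.Γ'.bit0 := by
    intro p
    induction p with
    | one => simp [PartrecToTM2.trPosNum]
    | bit0 p ih =>
      rw [PosNum.cast_bit0, ← two_mul, Nat.bit0_bits _ (PosNum.to_nat_pos p).ne']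
      simp [PartrecToTM2.trPosNum, ih]
    | bit1 p ih =>
      rw [PosNum.cast_bit1, ← two_mul, Nat.bit1_bits]
      simp [PartrecToTM2.trPosNum, ih]
  have hnum : ∀ p : Num, PartrecToTM2.trNum p =
      (p : ℕ).bits.map fun b => cond b PartrecToTM2.Γ'.bit1 PartrecToTM2.Γ'.bit0 := by
    rintro (- | p)
    · simp [PartrecToTM2.trNum]
    · exact hpos p
  rw [PartrecToTM2.trNat, hnum, Num.to_of_nat]

/-- A supported machine is equivalent to one whose states are the supporting ones. -/
theorem TM0.exists_restrict_states {Γ Λ : Type*} [Inhabited Γ] [Inhabited Λ] (M : TM0.Machine Γ Λ)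
    (S : Finset Λ) (hS : TM0.Supports M S) :
    ∃ (_ : Inhabited S) (M' : TM0.Machine Γ S), ∀ l, (TM0.eval M' l).Dom ↔ (TM0.eval M l).Dom := by
  classical
  let _ : Inhabited S := ⟨⟨default, hS.1⟩⟩
  let g₁ : PointedMap Λ S := ⟨fun q => if h : q ∈ S then ⟨q, h⟩ else default, by
    have h : default ∈ S := hS.1
    exact dif_pos h⟩
  let f : PointedMap Γ Γ := ⟨id, rfl⟩
  refine ⟨inferInstance, M.map f f g₁ Subtype.val, fun l => ?_⟩
  refine StateTransition.tr_eval_dom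
    (TM0.Machine.map_respects M f f g₁ Subtype.val hS (fun _ => rfl) fun q hq => ?_) ⟨hS.1, ?_⟩
  · have hq' : q ∈ S := hq
    change ((if h : q ∈ S then (⟨q, h⟩ : S) else default : S) : Λ) = q
    rw [dif_pos hq']
  · have := TM0.map_init (Λ := Λ) f g₁ l
    rw [this]
    congr 1
    exact List.map_id l

/-- A Turing machine that halts on the binary expansions of exactly those numbers that encode a
halting program. -/
theorem exists_universal_machine : ∃ (Γ Λ : Type) (_ : Inhabited Γ) (_ : Inhabited Λ)
    (_ : Finite Γ) (_ : Finite Λ) (M : TM0.Machine Γ Λ) (a : Γ) (f : Bool → Γ),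
    ∀ c : Nat.Partrec.Code, (TM0.eval M (a :: (Encodable.encode c).bits.reverse.map f)).Dom ↔
      (c.eval 0).Dom := by
  classical
  have hu : Partrec fun n : ℕ => (Denumerable.ofNat Nat.Partrec.Code n).eval 0 :=
    Nat.Partrec.Code.eval_part.comp (Computable.ofNat _) (Computable.const 0)
  obtain ⟨c, hc⟩ := ToPartrec.Code.exists_code (Nat.Partrec'.part_iff₁.2 hu)
  -- the machine starts in its default state
  let _ : Inhabited PartrecToTM2.Λ' := ⟨PartrecToTM2.trNormal c PartrecToTM2.Cont'.halt⟩
  let M2 : PartrecToTM2.Λ' →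
    TM2.Stmt (fun _ : PartrecToTM2.K' => PartrecToTM2.Γ') PartrecToTM2.Λ'
      (Option PartrecToTM2.Γ') := PartrecToTM2.tr
  have s2 : TM2.Supports M2 (PartrecToTM2.codeSupp c PartrecToTM2.Cont'.halt) :=
    PartrecToTM2.tr_supports c _
  have s1 := TM2to1.tr_supports M2 s2
  have s0 := TM1to0.tr_supports (TM2to1.tr M2) s1
  obtain ⟨hI, M', hM'⟩ := TM0.exists_restrict_states _ _ s0
  have hΓ : Finite (TM2to1.Γ' PartrecToTM2.K' fun _ => PartrecToTM2.Γ') := by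
    have : Finite PartrecToTM2.K' := Finite.of_injective
      (fun k => (PartrecToTM2.K'.rec 0 1 2 3 k : Fin 4)) (by rintro (_ | _) (_ | _) <;> simp)
    exact inferInstanceAs (Finite (Bool × ∀ _ : PartrecToTM2.K', Option PartrecToTM2.Γ'))
  refine ⟨_, _, inferInstance, hI, hΓ, inferInstance, M',
    (true, Function.update (fun _ => none) PartrecToTM2.K'.main (some PartrecToTM2.Γ'.cons)),
    fun b => (false, Function.update (fun _ => none) PartrecToTM2.K'.main
      (some (cond b PartrecToTM2.Γ'.bit1 PartrecToTM2.Γ'.bit0))), fun d => ?_⟩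
  have hin : TM2to1.trInit PartrecToTM2.K'.main (PartrecToTM2.trList [Encodable.encode d]) =
      ((true, Function.update (fun _ => none) PartrecToTM2.K'.main
        (some PartrecToTM2.Γ'.cons)) ::
        (Encodable.encode d).bits.reverse.map fun b => (false, Function.update (fun _ => none)
          PartrecToTM2.K'.main (some (cond b PartrecToTM2.Γ'.bit1 PartrecToTM2.Γ'.bit0))) :
        List (TM2to1.Γ' PartrecToTM2.K' fun _ => PartrecToTM2.Γ')) := by
    simp only [TM2to1.trInit, PartrecToTM2.trList, PartrecToTM2.trNat_eq_map_bits,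
      List.reverse_append, List.reverse_cons, List.reverse_nil, List.nil_append,
      List.singleton_append, ← List.map_reverse]
    exact congrArg (List.cons _) List.map_map
  rw [hM', ← hin, TM1to0.tr_eval, TM2to1.tr_eval_dom]
  have hinit : TM2.init PartrecToTM2.K'.main (PartrecToTM2.trList [Encodable.encode d]) =
      PartrecToTM2.init c [Encodable.encode d] := by
    unfold TM2.init PartrecToTM2.init
    congr 1
    funext k
    cases k <;> rfl
  change (StateTransition.eval (TM2.step PartrecToTM2.tr) (TM2.init PartrecToTM2.K'.main
    (PartrecToTM2.trList [Encodable.encode d]))).Dom ↔ _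
  rw [hinit, PartrecToTM2.tr_eval]
  have := hc ⟨[Encodable.encode d], rfl⟩
  change (ToPartrec.Code.eval c [Encodable.encode d]).Dom ↔ _
  rw [show ToPartrec.Code.eval c [Encodable.encode d] = _ from this]
  change ((Denumerable.ofNat Nat.Partrec.Code (Encodable.encode d)).eval 0).Dom ↔ _
  rw [Denumerable.ofNat_encode]

end Turing

/-! ### Computability of the reduction -/

namespace RCC8Formula

theorem primrec_toNat : Primrec toNat :=
  (Primrec.of_equiv : Primrec equivNat)

theorem primrec_of_toNat {α : Type*} [Primcodable α] {f : α → RCC8Formula}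
    (h : Primrec fun a => (f a).toNat) : Primrec f :=
  (Primrec.of_equiv_iff equivNat).1 h

theorem primrec_neg : Primrec neg :=
  primrec_of_toNat (Primrec.nat_add.comp
    (Primrec.nat_mul.comp (Primrec.const 4) primrec_toNat) (Primrec.const 1))

theorem primrec_and : Primrec₂ and :=
  primrec_of_toNat (Primrec.nat_add.comp
    (Primrec.nat_mul.comp (Primrec.const 4) (Primrec₂.natPair.comp
      (primrec_toNat.comp Primrec.fst) (primrec_toNat.comp Primrec.snd))) (Primrec.const 2))

theorem primrec_box (r : RCC8) : Primrec (box r) :=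
  primrec_of_toNat (Primrec.nat_add.comp
    (Primrec.nat_mul.comp (Primrec.const 4) (Primrec.nat_add.comp
      (Primrec.nat_mul.comp (Primrec.const 8) primrec_toNat) (Primrec.const r.idx)))
    (Primrec.const 3))

theorem primrec_dia (r : RCC8) : Primrec (dia r) :=
  primrec_neg.comp ((primrec_box r).comp primrec_neg)

theorem primrec_fwd (k : ℕ) : Primrec (fwd k) :=
  (primrec_dia _).comp (primrec_and.comp (Primrec.const _)
    ((primrec_dia _).comp (primrec_and.comp (Primrec.const _) Primrec.id)))

theorem primrec_univ : Primrec univ :=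
  primrec_and.comp (primrec_box _) <| primrec_and.comp (primrec_box _) <|
    primrec_and.comp (primrec_box _) <| primrec_and.comp (primrec_box _) <|
    primrec_and.comp (primrec_box _) <| primrec_and.comp (primrec_box _) <|
    primrec_and.comp (primrec_box _) <| primrec_and.comp (primrec_box _) <| Primrec.const _

theorem primrec_exi : Primrec exi := primrec_neg.comp (primrec_univ.comp primrec_neg)

end RCC8Formula

/-- Folding along the binary expansion of a number, least significant bit first, is primitive
recursive. -/
theorem primrec_foldl_bits {α : Type*} [Primcodable α] {f : Bool → α → α} (hf : Primrec₂ f) (a : α) :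
    Primrec fun n : ℕ => n.bits.foldl (fun x b => f b x) a := by
  let step : ℕ × α → ℕ × α := fun p => if p.1 = 0 then p else (p.1.div2, f p.1.bodd p.2)
  have hstep : Primrec step :=
    Primrec.ite (Primrec.eq.comp Primrec.fst (Primrec.const 0)) Primrec.id
      (Primrec.pair (Primrec.nat_div2.comp Primrec.fst)
        (hf.comp (Primrec.nat_bodd.comp Primrec.fst) Primrec.snd))
  have key : ∀ k n x, n ≤ k → (step^[k] (n, x)).2 = n.bits.foldl (fun x b => f b x) x := by
    intro k
    induction k with
    | zero =>
      intro n x hn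
      obtain rfl : n = 0 := by omega
      simp
    | succ k ih =>
      intro n x hn
      rw [Function.iterate_succ_apply]
      rcases Nat.eq_zero_or_pos n with rfl | hn0
      · simpa [step] using ih 0 x (Nat.zero_le _)
      · have h1 : step (n, x) = (n.div2, f n.bodd x) := if_neg hn0.ne'
        have h2 : n.bits = n.bodd :: n.div2.bits := by
          conv_lhs => rw [← Nat.bit_bodd_div2 n]
          refine Nat.bits_append_bit _ _ fun h => ?_
          have := Nat.bit_bodd_div2 n
          rw [h] at this
          cases hb : n.bodd
          · rw [hb] at this
            exact absurd this.symm hn0.ne'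
          · rfl
        rw [h1, ih _ _ (by rw [Nat.div2_val]; omega), h2, List.foldl_cons]
  refine (Primrec.snd.comp (Primrec.nat_iterate Primrec.id
    (Primrec.pair Primrec.id (Primrec.const a)) (hstep.comp Primrec.snd).to₂)).of_eq fun n => ?_
  exact key n n a le_rfl

namespace TileSystem

variable {Θ : Type*} [Fintype Θ] (T : TileSystem Θ)

open RCC8Formula

theorem word_map_reverse (f : Bool → Θ) (l : List Bool) :
    T.word (l.reverse.map f) = l.foldl (fun φ b => and (tile (f b)) (fwd 1 φ)) (T.word []) := by
  rw [← List.foldr_reverse]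
  induction l.reverse with
  | nil => rfl
  | cons b l ih => exact congrArg (fun φ => and (tile (f b)) (fwd 1 φ)) ih

theorem primrec_formula (a : Θ) (f : Bool → Θ) :
    Primrec fun n : ℕ => T.formula (a :: n.bits.reverse.map f) := by
  simp only [formula, start, word, word_map_reverse]
  have hletter : Primrec₂ fun (b : Bool) φ => and (tile (f b)) (fwd 1 φ) :=
    primrec_and.comp ((Primrec.dom_finite fun b => tile (f b)).comp Primrec.fst)
      ((primrec_fwd 1).comp Primrec.snd)
  refine primrec_and.comp (Primrec.const _) (primrec_exi.comp ?_)
  refine primrec_and.comp (Primrec.const _) (primrec_and.comp (Primrec.const _)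
    (primrec_and.comp (Primrec.const _) (primrec_and.comp (Primrec.const _) ?_)))
  exact (primrec_fwd 1).comp (primrec_foldl_bits hletter _)

end TileSystem

/-! ### Undecidability -/

/-- The negated tiling formula belongs to the logic of finite substructures if and only if there is
no tiling. -/
theorem neg_formula_mem_rcc8FinLogic_iff {S : Set RCC8Structure.{u}} (hS : S ⊆ classRS)
    {R : RCC8Structure.{u}} (hR : R ∈ S) {g : ℕ × ℕ → R.W} (hg : R.IsIntervalGrid g)
    {Θ : Type*} [Fintype Θ] (T : TileSystem Θ) (L : List Θ) :
    .neg (T.formula L) ∈ rcc8FinLogic S ↔ ¬ ∃ N m s τ, T.IsTiling L N m s τ := by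
  constructor
  · rintro h ⟨N, m, s, τ, ht⟩
    obtain ⟨A, hA, hAne, V, w, hw⟩ := hg.exists_sat (hS hR) ht
    exact h _ ⟨R, hR, A, hA, hAne, rfl⟩ V w hw
  · rintro h _ ⟨R', hR', A, hA, hAne, rfl⟩ V w hw
    have : Finite (R'.restrict A).W := hA
    exact h (T.exists_isTiling_of_sat ((hS hR').restrict hAne) hw)

theorem not_rePred_rcc8FinLogic {S : Set RCC8Structure.{u}} (hS : S ⊆ classRS)
    {R : RCC8Structure.{u}} (hR : R ∈ S) {g : ℕ × ℕ → R.W} (hg : R.IsIntervalGrid g) :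
    ¬ REPred fun φ : RCC8Formula => φ ∈ rcc8FinLogic S := by
  intro h
  have h' : Partrec fun φ => Part.assert (φ ∈ rcc8FinLogic S) fun _ => Part.some () := h
  obtain ⟨Γ, Λ, _, _, _, _, M, a, f, hM⟩ := Turing.exists_universal_machine
  have := Fintype.ofFinite (Turing.TM0.HeadTile Γ Λ)
  let T := Turing.TM0.tileSystem M
  let F : ℕ → RCC8Formula := fun n => .neg (T.formula
    (some (a, some default) :: n.bits.reverse.map fun b => some (f b, none)))
  have hF : Computable F :=
    (RCC8Formula.primrec_neg.comp (T.primrec_formula _ _)).to_comp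
  refine ComputablePred.halting_problem_not_re 0 (REPred.of_eq
    (h'.comp (hF.comp Computable.encode)) fun c => ?_)
  have hin : (some (a, some default) :: (Encodable.encode c).bits.reverse.map fun b =>
      some (f b, none) : List (Turing.TM0.HeadTile Γ Λ)) =
      Turing.TM0.inputTiles (a :: (Encodable.encode c).bits.reverse.map f) := by
    simp [Turing.TM0.inputTiles]
  simp only [F]
  rw [hin, neg_formula_mem_rcc8FinLogic_iff hS hR hg, ← hM c]
  refine not_congr ⟨?_, Turing.TM0.exists_isTiling_of_halts M⟩
  rintro ⟨N, m, s, τ, ht⟩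
  exact Turing.TM0.halts_of_isTiling M ht

theorem mainTheorem3 :
    (∀ (S : Set RCC8Structure.{u}) (n : ℕ), 1 ≤ n →
      (∃ R ∈ S, Nonempty (R.Iso (rectStructure n))) → S ⊆ classRS →
      ¬ ComputablePred (fun φ : RCC8Formula => φ ∈ rcc8FinLogic S)) ∧
    (∀ n : ℕ, 1 ≤ n →
      ¬ REPred (fun φ : RCC8Formula => φ ∈ rcc8FinLogic classRS.{u}) ∧
      ¬ REPred (fun φ : RCC8Formula => φ ∈ rcc8FinLogic classTOP.{u}) ∧
      ¬ REPred (fun φ : RCC8Formula => φ ∈ rcc8FinLogic {regStructure n}) ∧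
      ¬ REPred (fun φ : RCC8Formula => φ ∈ rcc8FinLogic {rectStructure n})) := by
  refine ⟨?_, fun n hn => ?_⟩
  · rintro S n hn ⟨R, hR, ⟨e⟩⟩ hS h
    obtain ⟨g, hg⟩ := exists_isIntervalGrid_rectStructure hn
    exact not_rePred_rcc8FinLogic hS hR (hg.iso e) h.to_re
  · obtain ⟨R, hR, g, hg⟩ := exists_classTOP_isIntervalGrid.{u}
    obtain ⟨g₁, hg₁⟩ := exists_isIntervalGrid_regStructure hn
    obtain ⟨g₂, hg₂⟩ := exists_isIntervalGrid_rectStructure hn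
    exact ⟨not_rePred_rcc8FinLogic subset_rfl (classTOP_subset_classRS hR) hg,
      not_rePred_rcc8FinLogic classTOP_subset_classRS hR hg,
      not_rePred_rcc8FinLogic (Set.singleton_subset_iff.2 (regStructure_mem_classRS n)) rfl hg₁,
      not_rePred_rcc8FinLogic (Set.singleton_subset_iff.2 (rectStructure_mem_classRS n)) rfl hg₂⟩
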